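/- Let $\mathfrak g$ be an affine Lie algebra of type $X_N^{(r)}$ (in Kac's tables), with Dynkin diagram vertices $0,\dots,n$, simple roots $\alpha_i$, simple coroots $\alpha_i^\vee$, labels $a_i$, dual labels $a_i^\vee$, and dual Coxeter number $h^\vee=\sum_{i=0}^n a_i^\vee$. Let $\mathring{\mathfrak g}$ be the finite-dimensional simple Lie algebra belonging to the vertices $1,\dots,n$, with weight lattice $\mathring P$ and Weyl group $\mathring W$, let $\varepsilon(w)=(-1)^{\ell(w)}$ be the sign character of $\mathring W$, and use the normalized invariant form $\langle\cdot,\cdot\rangle$, for which $\langle\alpha_i,\alpha_j\rangle=\frac{a_i^\vee}{a_i}\langle\alpha_i^\vee,\alpha_j\rangle$, to identify the Cartan subalgebra of $\mathring{\mathfrak g}$ with its dual. Put $\theta=\sum_{i=1}^n a_i\alpha_i$, let $M$ be the lattice spanned by $\mathring W(a_0^{-1}\theta)$, and let $M^\circ=\{v:\langle v,x\rangle\in\mathbb Z\text{ for all }x\in M\}$. Let $\ell$ be a positive integer and $G_\ell=\mathring P/(\ell+h^\vee)M$, with Pontryagin dual $\widehat G_\ell=\mathrm{Hom}(G_\ell,S^1)$.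 For $f=\sum_\sigma f(\sigma)e^\sigma\in\mathbb C[G_\ell]$ let $\widehat f(\chi)=|G_\ell|^{-1/2}\sum_{\sigma\in G_\ell}f(\sigma)\overline{\chi(\sigma)}$ for $\chi\in\widehat G_\ell$. For $v\in M^\circ$ let $\iota_1(v)=e^{\frac{2\pi i}{\ell+h^\vee}\langle v,\cdot\rangle}\in\widehat G_\ell$. For $x\in\mathring P$ let $A_x=\sum_{w\in\mathring W}\varepsilon(w)e^{w(x)}\in\mathbb C[G_\ell]$. Let $\Lambda_0,\dots,\Lambda_n$ and $\Lambda_0^\vee,\dots,\Lambda_n^\vee$ be the fundamental weights and coweights of $\mathfrak g$, and put $\rho=\sum_i\Lambda_i$, $\rho^\vee=\sum_i\Lambda_i^\vee$. The bar denotes projection to the (co)weights of $\mathring{\mathfrak g}$: it kills $\Lambda_0$ and $\Lambda_0^\vee$, and for $i\ge 1$ it sends $\Lambda_i$, $\Lambda_i^\vee$ to the $i$-th fundamental weight, coweight of $\mathring{\mathfrak g}$. Let $P_\ell^+$ be the set of dominant weights of level $\ell$, that is, $$P_\ell^+=\Big\{\sum_{i=0}^n m_i\Lambda_i:\ m_i\in\mathbb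 Z_{\ge0},\ \sum_{i=0}^n a_i^\vee m_i=\ell\Big\}.$$ Let $c_0=1$ and let $\sum_{i=1}^n c_i\alpha_i$ be the highest root of $\mathring{\mathfrak g}$. Let $P_\ell^{\vee+}$ be the set of dominant coweights of level $\ell$, that is, $$P_\ell^{\vee+}=\Big\{\sum_{i=0}^n m_i\Lambda_i^\vee:\ m_i\in\mathbb Z_{\ge0},\ \sum_{i=0}^n c_i m_i=\ell\Big\}.$$ (When $r>a_0$, the $c_i$ are the dual labels of the affine Lie algebra adjacent to $\mathfrak g$, and $\rho^\vee$ has level $h^\vee$.) **Proposition.** 1. If $r\le a_0$, then the functions $\widehat A_{\bar\lambda+\bar\rho}$, $\lambda\in P_\ell^+$, restricted to the set $\{\iota_1(\bar\mu+\bar\rho):\mu\in P_\ell^+\}\subseteq\widehat G_\ell$, are linearly independent over $\mathbb C$. 2. If $r>a_0$, then the functions $\widehat A_{\bar\lambda+\bar\rho}$, $\lambda\in P_\ell^+$, restricted to the set $\{\iota_1(\bar\mu+\bar\rho^\vee):\mu\in P_\ell^{\vee+}\}\subseteq\widehat G_\ell$, are linearly independent over $\mathbb C$. Moreover, the sets $P_\ell^+$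 and $P_\ell^{\vee+}$ are finite and $|P_\ell^+|=|P_\ell^{\vee+}|$. -/

import Mathlib

/-- The types `X_N^{(r)}` of affine Lie algebras. -/
inductive AffineType : Type
  /-- `A_n^{(1)}`, `n ≥ 1`. -/
  | A (n : ℕ) (hn : 1 ≤ n)
  /-- `B_n^{(1)}`, `n ≥ 3`. -/
  | B (n : ℕ) (hn : 3 ≤ n)
  /-- `C_n^{(1)}`, `n ≥ 2`. -/
  | C (n : ℕ) (hn : 2 ≤ n)
  /-- `D_n^{(1)}`, `n ≥ 4`. -/
  | D (n : ℕ) (hn : 4 ≤ n)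
  /-- `E_6^{(1)}`. -/
  | E6
  /-- `E_7^{(1)}`. -/
  | E7
  /-- `E_8^{(1)}`. -/
  | E8
  /-- `F_4^{(1)}`. -/
  | F4
  /-- `G_2^{(1)}`. -/
  | G2
  /-- `A_{2n}^{(2)}`, `n ≥ 1`. -/
  | A2even (n : ℕ) (hn : 1 ≤ n)
  /-- `A_{2n-1}^{(2)}`, `n ≥ 3`. -/
  | A2odd (n : ℕ) (hn : 3 ≤ n)
  /-- `D_{n+1}^{(2)}`, `n ≥ 2`. -/
  | D2 (n : ℕ) (hn : 2 ≤ n)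
  /-- `E_6^{(2)}`. -/
  | E62
  /-- `D_4^{(3)}`. -/
  | D43

namespace AffineType

/-- The rank `n` of the finite-dimensional algebra `g°`; the Dynkin diagram of `g` has the
vertices `0, …, n`, and `g°` belongs to the vertices `1, …, n`. -/
def rank : AffineType → ℕ
  | A n _ => n
  | B n _ => n
  | C n _ => n
  | D n _ => n
  | E6 => 6
  | E7 => 7
  | E8 => 8
  | F4 => 4
  | G2 => 2
  | A2even n _ => n
  | A2odd n _ => n
  | D2 n _ => n
  | E62 => 4
  | D43 => 2

/-- The number `r` in the type `X_N^{(r)}`. -/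
def r : AffineType → ℕ
  | A2even _ _ => 2
  | A2odd _ _ => 2
  | D2 _ _ => 2
  | E62 => 2
  | D43 => 3
  | _ => 1

/-- The matrix entries of a simply laced diagram with the given bonds. -/
def link (bond : ℕ → ℕ → Bool) (i j : ℕ) : ℤ :=
  if i = j then 2 else if bond i j || bond j i then -1 else 0

/-- The entry `⟨α_i^∨, α_j⟩` of the generalized Cartan matrix, for `0 ≤ i, j ≤ n`. -/
def cartanEntry : AffineType → ℕ → ℕ → ℤ
  | A n _, i, j =>
      if n = 1 then (if i = j then 2 else -2)
      else link (fun p q => q = p + 1 || (p = 0 && q = n)) i j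
  | B n _, i, j =>
      if i = n ∧ j + 1 = n then -2
      else link (fun p q => (p = 0 && q = 2) || (1 ≤ p && q = p + 1)) i j
  | C n _, i, j =>
      if (i = 1 ∧ j = 0) ∨ (i + 1 = n ∧ j = n) then -2
      else link (fun p q => q = p + 1) i j
  | D n _, i, j =>
      link (fun p q => (p = 0 && q = 2) || (1 ≤ p && q = p + 1 && p + 2 ≤ n)
        || (p + 2 = n && q = n)) i j
  | E6, i, j =>
      link (fun p q => (1 ≤ p && p ≤ 4 && q = p + 1) || (p = 3 && q = 6) || (p = 0 && q = 6)) i j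
  | E7, i, j =>
      link (fun p q => (p ≤ 5 && q = p + 1) || (p = 3 && q = 7)) i j
  | E8, i, j =>
      link (fun p q => (p ≤ 6 && q = p + 1) || (p = 5 && q = 8)) i j
  | F4, i, j =>
      if i = 3 ∧ j = 2 then -2 else link (fun p q => q = p + 1) i j
  | G2, i, j =>
      if i = 2 ∧ j = 1 then -3 else link (fun p q => q = p + 1) i j
  | A2even n _, i, j =>
      if n = 1 ∧ i = 0 ∧ j = 1 then -4
      else if 2 ≤ n ∧ ((i = 0 ∧ j = 1) ∨ (i + 1 = n ∧ j = n)) then -2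
      else link (fun p q => q = p + 1) i j
  | A2odd n _, i, j =>
      if i + 1 = n ∧ j = n then -2
      else link (fun p q => (p = 0 && q = 2) || (1 ≤ p && q = p + 1)) i j
  | D2 n _, i, j =>
      if (i = 0 ∧ j = 1) ∨ (i = n ∧ j + 1 = n) then -2
      else link (fun p q => q = p + 1) i j
  | E62, i, j =>
      if i = 2 ∧ j = 3 then -2 else link (fun p q => q = p + 1) i j
  | D43, i, j =>
      if i = 1 ∧ j = 2 then -3 else link (fun p q => q = p + 1) i j

/-- The numerical labels `a_0, …, a_n` of the Dynkin diagram: the coprime positive integers with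
`∑ j, ⟨α_i^∨, α_j⟩ a_j = 0` for all `i`. -/
def label : AffineType → ℕ → ℕ
  | A _ _, _ => 1
  | B _ _, i => if i ≤ 1 then 1 else 2
  | C n _, i => if i = 0 ∨ i = n then 1 else 2
  | D n _, i => if i ≤ 1 ∨ n ≤ i + 1 then 1 else 2
  | E6, i => [1, 1, 2, 3, 2, 1, 2].getD i 0
  | E7, i => [1, 2, 3, 4, 3, 2, 1, 2].getD i 0
  | E8, i => [1, 2, 3, 4, 5, 6, 4, 2, 3].getD i 0
  | F4, i => [1, 2, 3, 4, 2].getD i 0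
  | G2, i => [1, 2, 3].getD i 0
  | A2even n _, i => if i = n then 1 else 2
  | A2odd n _, i => if i ≤ 1 ∨ i = n then 1 else 2
  | D2 _ _, _ => 1
  | E62, i => [1, 2, 3, 2, 1].getD i 0
  | D43, i => [1, 2, 1].getD i 0

/-- The dual labels `a_0^∨, …, a_n^∨`: the coprime positive integers with
`∑ i, a_i^∨ ⟨α_i^∨, α_j⟩ = 0` for all `j`. -/
def dualLabel : AffineType → ℕ → ℕ
  | A _ _, _ => 1
  | B n _, i => if i ≤ 1 ∨ i = n then 1 else 2
  | C _ _, _ => 1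
  | D n _, i => if i ≤ 1 ∨ n ≤ i + 1 then 1 else 2
  | E6, i => [1, 1, 2, 3, 2, 1, 2].getD i 0
  | E7, i => [1, 2, 3, 4, 3, 2, 1, 2].getD i 0
  | E8, i => [1, 2, 3, 4, 5, 6, 4, 2, 3].getD i 0
  | F4, i => [1, 2, 3, 2, 1].getD i 0
  | G2, i => [1, 2, 1].getD i 0
  | A2even _ _, i => if i = 0 then 1 else 2
  | A2odd _ _, i => if i ≤ 1 then 1 else 2
  | D2 n _, i => if i = 0 ∨ i = n then 1 else 2
  | E62, i => [1, 2, 3, 4, 2].getD i 0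
  | D43, i => [1, 2, 3].getD i 0

/-- The levels `c_0, …, c_n` of the fundamental coweights `Λ_0^∨, …, Λ_n^∨`: `c_0 = 1`, and
`c_1, …, c_n` are the coefficients of the highest root of `g°` in the simple roots. If `r > a_0`,
these are the dual labels of the affine algebra adjacent to `g`, whose finite Weyl group and
lattice of finite weights are those of `g°` acting on the coweights; if `r ≤ a_0`, the highest
root of `g°` is `∑ i ≥ 1, a_i α_i`. -/
def coweightLabel : AffineType → ℕ → ℕ
  | A2odd n _, i => if i = 0 ∨ i = n then 1 else 2
  | D2 _ _, i => if i ≤ 1 then 1 else 2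
  | E62, i => [1, 2, 4, 3, 2].getD i 0
  | D43, i => [1, 3, 2].getD i 0
  | X, i => if i = 0 then 1 else X.label i

/-- The dual Coxeter number `h^∨ = ∑ i, a_i^∨`. -/
def dualCoxeter (X : AffineType) : ℕ := ∑ i : Fin (X.rank + 1), X.dualLabel i

theorem cartanEntry_self (X : AffineType) (i : ℕ) : X.cartanEntry i i = 2 := by
  cases X <;> simp [cartanEntry, link] <;> omega

noncomputable section

/-- The real form of the dual of the Cartan subalgebra of `g°`, with coordinates with respect to the
fundamental weights: the `i`-th coordinate of `x` is `⟨x, α_i^∨⟩` (here and below, the index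
`i : Fin n` stands for the vertex `i + 1`). The Cartan subalgebra itself is identified with this
space by the normalized invariant form. -/
abbrev Space (X : AffineType) : Type := Fin X.rank → ℝ

/-- The Cartan matrix of `g°`. -/
def finiteCartan (X : AffineType) : Matrix (Fin X.rank) (Fin X.rank) ℝ :=
  Matrix.of fun i j => (X.cartanEntry (i + 1) (j + 1) : ℝ)

/-- The simple root `α_j` of `g°`. -/
def simpleRoot (X : AffineType) (j : Fin X.rank) : X.Space := fun i => X.finiteCartan i j

/-- The linear form `x ↦ ⟨x, α_j^∨⟩`. -/
def simpleCoroot (X : AffineType) (j : Fin X.rank) : X.Space →ₗ[ℝ] ℝ := LinearMap.proj j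

/-- The normalized invariant form. It is the bilinear form with
`(α_i | y) = (a_i^∨ / a_i) ⟨y, α_i^∨⟩`, so that `(α_i | α_j) = (a_i^∨ / a_i) ⟨α_i^∨, α_j⟩`. -/
def form (X : AffineType) : X.Space →ₗ[ℝ] X.Space →ₗ[ℝ] ℝ :=
  Matrix.toLinearMap₂' ℝ (X.finiteCartan⁻¹.transpose *
    Matrix.diagonal fun i : Fin X.rank => (X.dualLabel (i + 1) : ℝ) / (X.label (i + 1) : ℝ))

theorem simpleCoroot_simpleRoot (X : AffineType) (j : Fin X.rank) :
    X.simpleCoroot j (X.simpleRoot j) = 2 := by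
  simp [simpleCoroot, simpleRoot, finiteCartan, cartanEntry_self]

/-- The simple reflection `s_j (x) = x - ⟨x, α_j^∨⟩ α_j`, for `j = 1, …, n`. -/
def simpleReflection (X : AffineType) (j : Fin X.rank) : X.Space ≃ₗ[ℝ] X.Space :=
  Module.reflection (X.simpleCoroot_simpleRoot j)

/-- The finite Weyl group. -/
def weylGroup (X : AffineType) : Subgroup (X.Space ≃ₗ[ℝ] X.Space) :=
  Subgroup.closure (Set.range X.simpleReflection)

/-- The length of an element of the finite Weyl group. -/
def length (X : AffineType) (w : X.weylGroup) : ℕ :=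
  sInf {k | ∃ l : List (Fin X.rank), l.length = k ∧
    (l.map X.simpleReflection).prod = (w : X.Space ≃ₗ[ℝ] X.Space)}

/-- The sign character `ε(w) = (-1)^{ℓ(w)}`. -/
def sign (X : AffineType) (w : X.weylGroup) : ℂ := (-1) ^ X.length w

/-- The weight lattice `P°` of `g°`. -/
def weightLattice (X : AffineType) : AddSubgroup X.Space where
  carrier := {x | ∀ i, ∃ m : ℤ, X.simpleCoroot i x = m}
  zero_mem' i := ⟨0, by simp⟩
  add_mem' hx hy i := by
    obtain ⟨a, ha⟩ := hx i
    obtain ⟨b, hb⟩ := hy i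
    exact ⟨a + b, by simp [ha, hb]⟩
  neg_mem' hx i := by
    obtain ⟨a, ha⟩ := hx i
    exact ⟨-a, by simp [ha]⟩

theorem simpleReflection_mem (X : AffineType) (j : Fin X.rank) {x : X.Space}
    (hx : x ∈ X.weightLattice) : X.simpleReflection j x ∈ X.weightLattice := by
  intro i
  obtain ⟨a, ha⟩ := hx i
  obtain ⟨b, hb⟩ := hx j
  refine ⟨a - b * X.cartanEntry (i + 1) (j + 1), ?_⟩
  rw [simpleReflection, Module.reflection_apply, map_sub, map_smul, ha, hb]
  simp [simpleCoroot, simpleRoot, finiteCartan]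

theorem weylGroup_mem (X : AffineType) (w : X.weylGroup) {x : X.Space}
    (hx : x ∈ X.weightLattice) : (w : X.Space ≃ₗ[ℝ] X.Space) x ∈ X.weightLattice := by
  obtain ⟨w, hw⟩ := w
  change w x ∈ X.weightLattice
  have key : ∀ j, (X.simpleReflection j)⁻¹ = X.simpleReflection j := fun j => by
    rw [inv_eq_iff_mul_eq_one]
    ext1 y
    exact Module.involutive_reflection (X.simpleCoroot_simpleRoot j) y
  induction hw using Subgroup.closure_induction'' generalizing x with
  | mem v hv =>
    obtain ⟨j, rfl⟩ := hv
    exact X.simpleReflection_mem j hx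
  | inv_mem v hv =>
    obtain ⟨j, rfl⟩ := hv
    rw [key]
    exact X.simpleReflection_mem j hx
  | one => exact hx
  | mul u v _ _ hu hv => exact hu (hv hx)

/-- The action of the finite Weyl group on the weight lattice. -/
def act (X : AffineType) (w : X.weylGroup) (x : X.weightLattice) : X.weightLattice :=
  ⟨(w : X.Space ≃ₗ[ℝ] X.Space) x, X.weylGroup_mem w x.2⟩

/-- The vector `θ = δ - a_0 α_0 = ∑ i ≥ 1, a_i α_i`. -/
def theta (X : AffineType) : X.Space :=
  ∑ i : Fin X.rank, (X.label (i + 1) : ℝ) • X.simpleRoot i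

/-- The lattice `M` spanned by the orbit of `θ / a_0` under the finite Weyl group. -/
def latticeM (X : AffineType) : AddSubgroup X.Space :=
  AddSubgroup.closure {x | ∃ w : X.weylGroup,
    x = (w : X.Space ≃ₗ[ℝ] X.Space) ((X.label 0 : ℝ)⁻¹ • X.theta)}

/-- The lattice `M°` of all `v` with `⟨v, x⟩ ∈ ℤ` for all `x ∈ M`. -/
def dualM (X : AffineType) : AddSubgroup X.Space where
  carrier := {v | ∀ x ∈ X.latticeM, ∃ m : ℤ, X.form v x = m}
  zero_mem' x _ := ⟨0, by simp⟩
  add_mem' hu hv x hx := by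
    obtain ⟨a, ha⟩ := hu x hx
    obtain ⟨b, hb⟩ := hv x hx
    exact ⟨a + b, by simp [ha, hb]⟩
  neg_mem' hu x hx := by
    obtain ⟨a, ha⟩ := hu x hx
    exact ⟨-a, by simp [ha]⟩

/-- The sublattice `(ℓ + h^∨) M`, as a subgroup of `P°`. -/
def scaledM (X : AffineType) (ℓ : ℕ) : AddSubgroup X.weightLattice :=
  (X.latticeM.map (nsmulAddMonoidHom (ℓ + X.dualCoxeter))).addSubgroupOf X.weightLattice

/-- The group `G_ℓ = P° / (ℓ + h^∨) M`. -/
abbrev G (X : AffineType) (ℓ : ℕ) : Type := X.weightLattice ⧸ X.scaledM ℓ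

/-- The homomorphism `x ↦ exp (2πi ⟨v, x⟩ / (ℓ + h^∨))` on `P°`. -/
def latticeChar (X : AffineType) (ℓ : ℕ) (v : X.Space) : X.weightLattice →+ Additive Circle :=
  Circle.expHom.comp <| (AddMonoidHom.mulLeft (2 * Real.pi / (ℓ + X.dualCoxeter : ℕ))).comp <|
    (X.form v).toAddMonoidHom.comp X.weightLattice.subtype

theorem latticeChar_eq_zero (X : AffineType) (ℓ : ℕ) (v : X.dualM) :
    X.scaledM ℓ ≤ (X.latticeChar ℓ v).ker := by
  rintro ⟨x, hx⟩ ⟨y, hy, hyx⟩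
  obtain ⟨m, hm⟩ := v.2 y hy
  have hxy : x = (ℓ + X.dualCoxeter) • y := hyx.symm
  rw [AddMonoidHom.mem_ker]
  change Additive.ofMul (Circle.exp (2 * Real.pi / (ℓ + X.dualCoxeter : ℕ) * X.form v x))
    = Additive.ofMul 1
  congr 1
  rw [hxy, map_nsmul, hm, nsmul_eq_mul]
  rcases Nat.eq_zero_or_pos (ℓ + X.dualCoxeter) with h | h
  · simp [h]
  · have h0 : ((ℓ + X.dualCoxeter : ℕ) : ℝ) ≠ 0 := by positivity
    rw [← Circle.exp_int_mul_two_pi m]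
    congr 1
    field_simp

/-- The character `ι_1(v) = exp (2πi ⟨v, ·⟩ / (ℓ + h^∨))` of `G_ℓ`, for `v ∈ M°`. -/
def iota (X : AffineType) (ℓ : ℕ) (v : X.dualM) : AddChar (X.G ℓ) Circle :=
  AddChar.toAddMonoidHomEquiv.symm
    (QuotientAddGroup.lift (X.scaledM ℓ) (X.latticeChar ℓ v) (X.latticeChar_eq_zero ℓ v))

/-- The Fourier transform of an element of the group algebra of an abelian group `G`, a function
on the Pontryagin dual of `G`. -/
def fourier {G : Type*} [AddCommGroup G] (f : AddMonoidAlgebra ℂ G) (χ : AddChar G Circle) : ℂ :=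
  (((Nat.card G : ℝ) ^ (-(1 / 2) : ℝ) : ℝ) : ℂ) *
    f.coeff.sum fun σ c => c * starRingEnd ℂ (χ σ : ℂ)

/-- The alternant `A_x = ∑ w, ε(w) e^{w x}` in the group algebra of `G_ℓ`. -/
def alternant (X : AffineType) (ℓ : ℕ) (x : X.weightLattice) : AddMonoidAlgebra ℂ (X.G ℓ) :=
  ∑ᶠ w : X.weylGroup, AddMonoidAlgebra.single (QuotientAddGroup.mk (X.act w x)) (X.sign w)

/-- The weight lattice `P` of `g` modulo `δ`, which the projection to `P°` kills: the free group
on `Λ_0, …, Λ_n`. -/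
abbrev AffineWeight (X : AffineType) : Type := Fin (X.rank + 1) → ℤ

/-- The lattice `P^∨`, the free group on `Λ_0^∨, …, Λ_n^∨`. -/
abbrev AffineCoweight (X : AffineType) : Type := Fin (X.rank + 1) → ℤ

/-- The set `P_ℓ^+` of dominant weights of level `ℓ`; the level of `Λ_i` is `a_i^∨`. -/
def dominantWeights (X : AffineType) (ℓ : ℕ) : Set X.AffineWeight :=
  {m | (∀ i, 0 ≤ m i) ∧ ∑ i : Fin (X.rank + 1), (X.dualLabel i : ℤ) * m i = ℓ}

/-- The set `P_ℓ^{∨+}` of dominant coweights of level `ℓ`; the level of `Λ_i^∨` is `c_i`. -/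
def dominantCoweights (X : AffineType) (ℓ : ℕ) : Set X.AffineCoweight :=
  {m | (∀ i, 0 ≤ m i) ∧ ∑ i : Fin (X.rank + 1), (X.coweightLabel i : ℤ) * m i = ℓ}

/-- The weight `ρ = Λ_0 + ⋯ + Λ_n`. -/
def rho (X : AffineType) : X.AffineWeight := fun _ => 1

/-- The coweight `ρ^∨ = Λ_0^∨ + ⋯ + Λ_n^∨`. -/
def rhoCheck (X : AffineType) : X.AffineCoweight := fun _ => 1

/-- The projection `λ ↦ λ̄` from the weights of `g` to those of `g°`; it kills `Λ_0`, and `Λ_i` is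
mapped to the `i`-th fundamental weight of `g°` for `i ≥ 1`. -/
def bar (X : AffineType) (m : X.AffineWeight) : X.weightLattice :=
  ⟨fun i => (m i.succ : ℝ), fun i => ⟨m i.succ, rfl⟩⟩

/-- The projection `μ ↦ μ̄` for coweights; it kills `Λ_0^∨`, and `Λ_i^∨` is mapped for `i ≥ 1` to
the vector with `⟨Λ_i^∨, α_j⟩ = δ_ij`, which the normalized form identifies with `a_i / a_i^∨` times
the `i`-th fundamental weight. -/
def cobar (X : AffineType) (m : X.AffineCoweight) : X.Space :=
  fun i => (m i.succ : ℝ) * ((X.label (i + 1) : ℝ) / (X.dualLabel (i + 1) : ℝ))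

/-- The set of the characters `ι_1(μ̄ + ρ̄)`, `μ ∈ P_ℓ^+`, of `G_ℓ`. -/
def weightPoints (X : AffineType) (ℓ : ℕ) : Set (AddChar (X.G ℓ) Circle) :=
  {χ | ∃ μ ∈ X.dominantWeights ℓ, ∃ v : X.dualM,
    (v : X.Space) = X.bar μ + X.bar X.rho ∧ X.iota ℓ v = χ}

/-- The set of the characters `ι_1(μ̄ + ρ̄^∨)`, `μ ∈ P_ℓ^{∨+}`, of `G_ℓ`. -/
def coweightPoints (X : AffineType) (ℓ : ℕ) : Set (AddChar (X.G ℓ) Circle) :=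
  {χ | ∃ μ ∈ X.dominantCoweights ℓ, ∃ v : X.dualM,
    (v : X.Space) = X.cobar μ + X.cobar X.rhoCheck ∧ X.iota ℓ v = χ}

end

end AffineType

/-!
Put `k = ℓ + h^∨`. Let `η = ∑ i ≥ 1, c_i α_i` be the highest root of the finite-dimensional
algebra, and let `f = ∑ g_λ A_{λ̄ + ρ̄}` be a linear combination whose Fourier transform vanishes
at the prescribed points. It is shown that the Fourier transform vanishes everywhere, so that
`f = 0`, and that the coefficients `g_λ` can be read off from `f`.

*The Fourier transform vanishes.* Every character of `G_ℓ` is `ι_1(v)` for some `v ∈ M°`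
(`iota_surjective`). As a function of `v`, the transform of `f` is antisymmetric under the finite
Weyl group, and it is invariant under translations by `k q` for all `q` that are integral on `P°`.
These transformations move `v` into the closed alcove `v_i ≥ 0`, `(η | v) ≤ k`
(`exists_mem_closed_alcove`). On a wall of the alcove the antisymmetry makes the transform vanish.
The points of `M°` in the interior are among the prescribed ones: if `r ≤ a_0`, then `M` contains
the vectors `(a_i / a_i^∨) α_i`, so that `M°` consists of weights, and `η = θ`; if `r > a_0`, then
`M` contains the simple roots, so that `M°` consists of coweights, and `ρ^∨` has level `h^∨`.

*The coefficients.* The points `λ̄ + ρ̄` lie in the open alcove `x_i > 0`, `(θ | x) < k`. Distinct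
points of it are inequivalent under the group generated by the finite Weyl group and the
translations by `k M`, and their stabilizers are trivial (`eq_one_and_eq_of_mem_alcove`). So the
coefficient of `f` at `λ̄ + ρ̄` is `g_λ` (`coeff_alternant`).

*Alcoves.* The inequivalence is a statement about the affine Weyl group as generated by its simple
reflections, and is proved for an arbitrary affine Cartan matrix (`CartanDatum`). The Gram form of
such a matrix is positive semidefinite with a positive null vector. For an integral vector of the
norm of a real root, with the divisibility properties of a root, this forces the coefficients to be
of one sign (`CartanDatum.nonneg_or_nonpos`); the exchange condition
(`CartanDatum.exists_exchange`) and then the inequivalence (`CartanDatum.weightWord_eq_one`)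
follow. The same lemma shows, by descent on the height, that the reflections in `θ` and in `η`
belong to the finite Weyl group (`exists_weyl_eq_reflection`); this gives the translations by
`k M`, and the reflection in the last wall of the closed alcove.

*The cardinalities.* If `r > a_0`, the levels `c_i` of the fundamental coweights are a
rearrangement of the levels `a_i^∨` of the fundamental weights (`exists_perm_coweightLabel`), and a
permutation of the coordinates maps `P_ℓ^+` onto `P_ℓ^{∨+}`.
-/

/-! ### Affine Cartan matrices and the sign of real roots -/

/-- A symmetrizable Cartan matrix of affine type on the vertices `0, …, n`, together with a
symmetrizer and a positive null vector. Connectedness of the diagram is the condition `conn`: a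
function that is constant along the edges is constant. -/
structure CartanDatum (n : ℕ) where
  /-- The matrix entries `⟨α_i^∨, α_j⟩`. -/
  A : Fin (n + 1) → Fin (n + 1) → ℤ
  /-- The symmetrizer; `d i` is half the squared length of `α_i`. -/
  d : Fin (n + 1) → ℝ
  /-- A positive null vector of the matrix. -/
  u : Fin (n + 1) → ℝ
  d_pos : ∀ i, 0 < d i
  u_pos : ∀ i, 0 < u i
  diag : ∀ i, A i i = 2
  offdiag : ∀ i j, i ≠ j → A i j ≤ 0
  symm : ∀ i j, d i * A i j = d j * A j i
  null : ∀ i, ∑ j, (A i j : ℝ) * u j = 0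
  conn : ∀ f : Fin (n + 1) → ℝ, (∀ i j, A i j ≠ 0 → f i = f j) → ∀ i j, f i = f j

namespace CartanDatum

variable {n : ℕ} (C : CartanDatum n)

/-- The invariant symmetric form on the span of the simple roots, for which
`(α_i | α_j) = d_i A_ij`, evaluated at two vectors of coefficients. -/
noncomputable def gram (b c : Fin (n + 1) → ℝ) : ℝ := ∑ i, ∑ j, C.d i * C.A i j * b i * c j

/-- The datum of the transposed matrix, in which the coroots play the part of the roots. -/
noncomputable def dual : CartanDatum n where
  A i j := C.A j i
  d i := (C.d i)⁻¹
  u i := C.d i * C.u i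
  d_pos i := inv_pos.2 (C.d_pos i)
  u_pos i := mul_pos (C.d_pos i) (C.u_pos i)
  diag i := C.diag i
  offdiag i j h := C.offdiag j i h.symm
  symm i j := by
    have h := C.symm i j
    have h1 := (C.d_pos i).ne'
    have h2 := (C.d_pos j).ne'
    field_simp
    linarith
  null i := by
    have h : ∀ j, (C.A j i : ℝ) * (C.d j * C.u j) = C.d i * (C.A i j * C.u j) := fun j => by
      have := C.symm i j
      linear_combination (-C.u j) * this
    simp only [h, ← Finset.mul_sum, C.null, mul_zero]
  conn f hf i j := C.conn f (fun i j h => by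
    refine (hf j i h).symm) i j

theorem gram_comm (b c : Fin (n + 1) → ℝ) : C.gram b c = C.gram c b := by
  unfold gram
  rw [Finset.sum_comm]
  refine Finset.sum_congr rfl fun i _ => Finset.sum_congr rfl fun j _ => ?_
  rw [C.symm j i]; ring

theorem gram_add_left (b b' c : Fin (n + 1) → ℝ) :
    C.gram (b + b') c = C.gram b c + C.gram b' c := by
  simp only [gram, ← Finset.sum_add_distrib, Pi.add_apply]
  refine Finset.sum_congr rfl fun i _ => Finset.sum_congr rfl fun j _ => by ring

theorem gram_smul_left (t : ℝ) (b c : Fin (n + 1) → ℝ) :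
    C.gram (t • b) c = t * C.gram b c := by
  simp only [gram, Finset.mul_sum, Pi.smul_apply, smul_eq_mul]
  refine Finset.sum_congr rfl fun i _ => Finset.sum_congr rfl fun j _ => by ring

theorem gram_smul_right (t : ℝ) (b c : Fin (n + 1) → ℝ) :
    C.gram b (t • c) = t * C.gram b c := by
  rw [gram_comm, gram_smul_left, gram_comm]

theorem gram_sub_left (b b' c : Fin (n + 1) → ℝ) :
    C.gram (b - b') c = C.gram b c - C.gram b' c := by
  have := C.gram_add_left (b - b') b' c
  rw [sub_add_cancel] at this; linarith

theorem gram_sub_right (b c c' : Fin (n + 1) → ℝ) :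
    C.gram b (c - c') = C.gram b c - C.gram b c' := by
  rw [gram_comm, gram_sub_left, gram_comm, C.gram_comm c']

theorem gram_single_left (i : Fin (n + 1)) (c : Fin (n + 1) → ℝ) :
    C.gram (Pi.single i 1) c = C.d i * ∑ j, C.A i j * c j := by
  unfold gram
  rw [Finset.sum_eq_single i]
  · simp [Finset.mul_sum, mul_assoc]
  · intro b _ hb; simp [hb]
  · simp

theorem gram_eq_sum_left (b c : Fin (n + 1) → ℝ) :
    C.gram b c = ∑ i, b i * (C.d i * ∑ j, C.A i j * c j) := by
  simp only [gram, Finset.mul_sum]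
  refine Finset.sum_congr rfl fun i _ => Finset.sum_congr rfl fun j _ => by ring

/-- The form as a sum of squares. The weights `-d_i A_ij u_i u_j / 2` are nonnegative, and the
terms in `b_i ^ 2` and `b_j ^ 2` that complete the squares cancel because `A u = 0`. -/
theorem gram_self (b : Fin (n + 1) → ℝ) :
    C.gram b b = ∑ i, ∑ j, -(C.d i * C.A i j * C.u i * C.u j) / 2 *
      (b i / C.u i - b j / C.u j) ^ 2 := by
  obtain ⟨y, rfl⟩ : ∃ y : Fin (n + 1) → ℝ, b = fun i => C.u i * y i :=
    ⟨fun i => b i / C.u i, funext fun i => by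
      have := (C.u_pos i).ne'
      field_simp⟩
  have hy : ∀ i, C.u i * y i / C.u i = y i := fun i => by
    have := (C.u_pos i).ne'
    field_simp
  simp only [hy]
  have e1 : ∑ i, ∑ j, C.d i * C.A i j * C.u i * C.u j * y i ^ 2 = 0 := by
    refine Finset.sum_eq_zero fun i _ => ?_
    have : ∀ j, C.d i * C.A i j * C.u i * C.u j * y i ^ 2
        = (C.d i * C.u i * y i ^ 2) * (C.A i j * C.u j) := fun j => by ring
    simp only [this, ← Finset.mul_sum, C.null, mul_zero]
  have e2 : ∑ i, ∑ j, C.d i * C.A i j * C.u i * C.u j * y j ^ 2 = 0 := by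
    rw [Finset.sum_comm, ← e1]
    refine Finset.sum_congr rfl fun i _ => Finset.sum_congr rfl fun j _ => ?_
    rw [C.symm j i]; ring
  have : C.gram (fun i => C.u i * y i) (fun i => C.u i * y i)
      = C.gram (fun i => C.u i * y i) (fun i => C.u i * y i)
      - (∑ i, ∑ j, C.d i * C.A i j * C.u i * C.u j * y i ^ 2) / 2
      - (∑ i, ∑ j, C.d i * C.A i j * C.u i * C.u j * y j ^ 2) / 2 := by rw [e1, e2]; ring
  rw [this]
  simp only [gram, Finset.sum_div, ← Finset.sum_sub_distrib]
  refine Finset.sum_congr rfl fun i _ => Finset.sum_congr rfl fun j _ => by ring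

theorem gram_term_nonneg (b : Fin (n + 1) → ℝ) (i j : Fin (n + 1)) :
    0 ≤ -(C.d i * C.A i j * C.u i * C.u j) / 2 * (b i / C.u i - b j / C.u j) ^ 2 := by
  rcases eq_or_ne i j with rfl | h
  · simp
  · have h1 : (C.A i j : ℝ) ≤ 0 := by exact_mod_cast C.offdiag i j h
    have h2 : 0 ≤ C.d i * C.u i * C.u j * (-(C.A i j : ℝ)) :=
      mul_nonneg (mul_pos (mul_pos (C.d_pos i) (C.u_pos i)) (C.u_pos j)).le (by linarith)
    refine mul_nonneg ?_ (sq_nonneg _)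
    linarith

theorem gram_self_nonneg (b : Fin (n + 1) → ℝ) : 0 ≤ C.gram b b := by
  rw [gram_self]
  exact Finset.sum_nonneg fun i _ => Finset.sum_nonneg fun j _ => C.gram_term_nonneg b i j

/-- By the sum of squares, isotropy of `b` forces `b_i / u_i = b_j / u_j` along every edge. -/
theorem eq_smul_of_gram_self_eq_zero {b : Fin (n + 1) → ℝ} (h : C.gram b b = 0) :
    ∃ t : ℝ, b = t • C.u := by
  rw [gram_self, Finset.sum_eq_zero_iff_of_nonneg fun i _ =>
    Finset.sum_nonneg fun j _ => C.gram_term_nonneg b i j] at h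
  have key : ∀ i j, b i / C.u i = b j / C.u j := by
    refine C.conn _ fun i j hij => ?_
    have h1 := h i (Finset.mem_univ _)
    rw [Finset.sum_eq_zero_iff_of_nonneg fun j _ => C.gram_term_nonneg b i j] at h1
    have h2 := h1 j (Finset.mem_univ _)
    rcases mul_eq_zero.1 h2 with h3 | h3
    · have := (C.d_pos i).ne'
      have := (C.u_pos i).ne'
      have := (C.u_pos j).ne'
      have : (C.A i j : ℝ) ≠ 0 := by exact_mod_cast hij
      simp_all
    · exact sub_eq_zero.1 (pow_eq_zero_iff (two_ne_zero) |>.1 h3)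
  refine ⟨b 0 / C.u 0, funext fun i => ?_⟩
  have := key 0 i
  have := (C.u_pos i).ne'
  simp only [Pi.smul_apply, smul_eq_mul, key 0 i]
  field_simp

/-- If all `d_i c_i` are multiples of `D`, then the norm of `c` is a multiple of `2 D`: the
diagonal terms are `2 d_i c_i ^ 2`, and each off-diagonal term occurs twice. -/
theorem exists_gram_self_eq {D : ℝ} (c : Fin (n + 1) → ℤ)
    (hc : ∀ i, ∃ z : ℤ, C.d i * c i = D * z) :
    ∃ z : ℤ, C.gram (fun i => (c i : ℝ)) (fun i => (c i : ℝ)) = 2 * D * z := by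
  choose z hz using hc
  have hsplit : C.gram (fun i => (c i : ℝ)) (fun i => (c i : ℝ))
      = ∑ i, ∑ j, (if i = j then 2 * C.d i * c i * c i else 0)
        + 2 * ∑ i, ∑ j, (if i < j then C.d i * C.A i j * c i * c j else 0) := by
    have h3 : ∑ i, ∑ j, (if j < i then C.d i * C.A i j * c i * c j else 0)
        = ∑ i, ∑ j, (if i < j then C.d i * C.A i j * c i * c j else 0) := by
      rw [Finset.sum_comm]
      refine Finset.sum_congr rfl fun i _ => Finset.sum_congr rfl fun j _ => ?_
      rw [C.symm j i]
      split_ifs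
      · ring
      · rfl
    rw [two_mul]
    nth_rw 1 [← h3]
    simp only [gram, ← Finset.sum_add_distrib]
    refine Finset.sum_congr rfl fun i _ => Finset.sum_congr rfl fun j _ => ?_
    rcases lt_trichotomy i j with h | rfl | h
    · simp [h, h.ne, h.not_gt]
    · rw [if_pos rfl, if_neg (lt_irrefl _), C.diag]; push_cast; ring
    · simp [h, h.ne', h.not_gt]
  refine ⟨∑ i, ∑ j, (if i = j then z i * c i else 0)
        + ∑ i, ∑ j, (if i < j then C.A i j * z i * c j else 0), ?_⟩
  rw [hsplit]
  push_cast
  rw [mul_add, Finset.mul_sum, Finset.mul_sum, Finset.mul_sum]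
  congr 1
  · refine Finset.sum_congr rfl fun i _ => ?_
    rw [Finset.mul_sum]
    refine Finset.sum_congr rfl fun j _ => ?_
    split_ifs
    · linear_combination (2 * (c i : ℝ)) * hz i
    · simp
  · refine Finset.sum_congr rfl fun i _ => ?_
    rw [Finset.mul_sum, Finset.mul_sum]
    refine Finset.sum_congr rfl fun j _ => ?_
    split_ifs
    · linear_combination (2 * (C.A i j : ℝ) * (c j : ℝ)) * hz i
    · simp

theorem eq_zero_or_pos_of_gram_self_eq_zero {c : Fin (n + 1) → ℤ} (hc : ∀ i, 0 ≤ c i)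
    (h : C.gram (fun i => (c i : ℝ)) (fun i => (c i : ℝ)) = 0) :
    (∀ i, c i = 0) ∨ (∀ i, 0 < c i) := by
  obtain ⟨t, ht⟩ := C.eq_smul_of_gram_self_eq_zero h
  have ht' : ∀ i, (c i : ℝ) = t * C.u i := fun i => congrFun ht i
  rcases lt_trichotomy t 0 with h0 | h0 | h0
  · exfalso
    have h1 := ht' 0
    have h2 : (0 : ℝ) ≤ c 0 := by exact_mod_cast hc 0
    nlinarith [C.u_pos 0]
  · left; intro i
    have := ht' i
    rw [h0, zero_mul] at this
    exact_mod_cast this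
  · right; intro i
    have := mul_pos h0 (C.u_pos i)
    rw [← ht' i] at this
    exact_mod_cast this

/-- Real roots are positive or negative. Write `c = p - q` with `p, q ≥ 0` of disjoint supports.
Then `(p | q) ≤ 0`, so that the norms of `p` and `q`, which are nonnegative multiples of `2 D`, add
up to at most `2 D`. One of them is therefore isotropic, that is, a multiple of `u`; it is zero, or
its support is everything and the other part is zero. -/
theorem nonneg_or_nonpos {D : ℝ} (hD : 0 < D) (c : Fin (n + 1) → ℤ)
    (hc : ∀ i, ∃ z : ℤ, C.d i * c i = D * z)
    (hn : C.gram (fun i => (c i : ℝ)) (fun i => (c i : ℝ)) = 2 * D) :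
    (∀ i, 0 ≤ c i) ∨ (∀ i, c i ≤ 0) := by
  set p : Fin (n + 1) → ℤ := fun i => max (c i) 0 with hp
  set q : Fin (n + 1) → ℤ := fun i => max (-c i) 0 with hq
  have hpq : ∀ i, c i = p i - q i := fun i => by simp only [hp, hq]; omega
  have hpq0 : ∀ i, p i = 0 ∨ q i = 0 := fun i => by simp only [hp, hq]; omega
  have hp0 : ∀ i, 0 ≤ p i := fun i => le_max_right _ _
  have hq0 : ∀ i, 0 ≤ q i := fun i => le_max_right _ _
  have hpd : ∀ i, ∃ z : ℤ, C.d i * p i = D * z := fun i => by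
    rcases max_choice (c i) 0 with h | h
    · simp only [hp, h]; exact hc i
    · exact ⟨0, by simp only [hp, h]; simp⟩
  have hqd : ∀ i, ∃ z : ℤ, C.d i * q i = D * z := fun i => by
    rcases max_choice (-c i) 0 with h | h
    · obtain ⟨z, hz⟩ := hc i
      refine ⟨-z, ?_⟩
      simp only [hq, h]
      push_cast
      linarith
    · exact ⟨0, by simp only [hq, h]; simp⟩
  obtain ⟨y, hy⟩ := C.exists_gram_self_eq p hpd
  obtain ⟨z, hz⟩ := C.exists_gram_self_eq q hqd
  have hcross : C.gram (fun i => (p i : ℝ)) (fun i => (q i : ℝ)) ≤ 0 := by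
    refine Finset.sum_nonpos fun i _ => Finset.sum_nonpos fun j _ => ?_
    rcases eq_or_ne i j with rfl | h
    · rcases hpq0 i with h | h <;> simp [h]
    · have h1 : (C.A i j : ℝ) ≤ 0 := by exact_mod_cast C.offdiag i j h
      have h2 : (0 : ℝ) ≤ p i := by exact_mod_cast hp0 i
      have h3 : (0 : ℝ) ≤ q j := by exact_mod_cast hq0 j
      have := mul_nonneg (mul_nonneg (mul_nonneg (C.d_pos i).le (neg_nonneg.2 h1)) h2) h3
      linarith
  have hexp : C.gram (fun i => (c i : ℝ)) (fun i => (c i : ℝ))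
      = C.gram (fun i => (p i : ℝ)) (fun i => (p i : ℝ))
      + C.gram (fun i => (q i : ℝ)) (fun i => (q i : ℝ))
      - 2 * C.gram (fun i => (p i : ℝ)) (fun i => (q i : ℝ)) := by
    have : (fun i => (c i : ℝ)) = (fun i => (p i : ℝ)) - (fun i => (q i : ℝ)) := by
      ext i; simp [hpq i]
    rw [this, gram_sub_left, gram_sub_right, gram_sub_right, C.gram_comm (fun i => (q i : ℝ))
      (fun i => (p i : ℝ))]
    ring
  have hy0 : 0 ≤ y := by
    have := C.gram_self_nonneg (fun i => (p i : ℝ))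
    rw [hy] at this
    exact_mod_cast nonneg_of_mul_nonneg_right this (by positivity)
  have hz0 : 0 ≤ z := by
    have := C.gram_self_nonneg (fun i => (q i : ℝ))
    rw [hz] at this
    exact_mod_cast nonneg_of_mul_nonneg_right this (by positivity)
  have hyz : y + z ≤ 1 := by
    have h1 : D * (y + z) ≤ D * 1 := by linarith
    have := le_of_mul_le_mul_left h1 hD
    exact_mod_cast this
  have hcase : y = 0 ∨ z = 0 := by omega
  rcases hcase with h | h
  · rw [h] at hy
    rcases C.eq_zero_or_pos_of_gram_self_eq_zero hp0 (by rw [hy]; simp) with h1 | h1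
    · right; intro i; rw [hpq i, h1 i]; have := hq0 i; omega
    · left; intro i
      have := h1 i
      rcases hpq0 i with h2 | h2
      · omega
      · rw [hpq i, h2]; omega
  · rw [h] at hz
    rcases C.eq_zero_or_pos_of_gram_self_eq_zero hq0 (by rw [hz]; simp) with h1 | h1
    · left; intro i; rw [hpq i, h1 i]; have := hp0 i; omega
    · right; intro i
      have := h1 i
      rcases hpq0 i with h2 | h2
      · rw [hpq i, h2]; omega
      · omega

/-! ### Words in the simple reflections and the exchange condition -/

/-- The simple reflection `s_i c = c - ⟨α_i^∨, c⟩ α_i` of the root lattice. -/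
def rootReflection (i : Fin (n + 1)) (c : Fin (n + 1) → ℤ) : Fin (n + 1) → ℤ :=
  c - Pi.single i (∑ j, C.A i j * c j)

/-- The simple reflection `s_i` acting on linear functionals on the root lattice; a functional is
given by its values `m j` on the simple roots. -/
noncomputable def weightReflection (i : Fin (n + 1)) : (Fin (n + 1) → ℝ) →ₗ[ℝ] (Fin (n + 1) → ℝ) :=
  LinearMap.id - (LinearMap.proj i).smulRight (fun j => (C.A i j : ℝ))

theorem weightReflection_apply (i j : Fin (n + 1)) (m : Fin (n + 1) → ℝ) :
    C.weightReflection i m j = m j - m i * C.A i j := by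
  simp [weightReflection]

theorem weightReflection_involutive (i : Fin (n + 1)) (m : Fin (n + 1) → ℝ) :
    C.weightReflection i (C.weightReflection i m) = m := by
  ext j
  simp only [weightReflection_apply, C.diag]
  push_cast; ring

/-- The product of the simple reflections along a word, acting on functionals. -/
noncomputable def weightWord (L : List (Fin (n + 1))) :
    (Fin (n + 1) → ℝ) →ₗ[ℝ] (Fin (n + 1) → ℝ) :=
  (L.map C.weightReflection).prod

/-- The product of the simple reflections along a word, acting on the root lattice as the transpose
of `weightWord`; the first letter is applied first. -/
def rootWord (L : List (Fin (n + 1))) (c : Fin (n + 1) → ℤ) : Fin (n + 1) → ℤ :=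
  L.foldl (fun c i => C.rootReflection i c) c

@[simp] theorem weightWord_nil : C.weightWord [] = 1 := rfl

@[simp] theorem weightWord_cons (i : Fin (n + 1)) (L : List (Fin (n + 1))) :
    C.weightWord (i :: L) = C.weightReflection i * C.weightWord L := by
  simp [weightWord]

theorem weightWord_append (L L' : List (Fin (n + 1))) :
    C.weightWord (L ++ L') = C.weightWord L * C.weightWord L' := by
  simp [weightWord]

theorem weightWord_reverse_mul (L : List (Fin (n + 1))) :
    C.weightWord L.reverse * C.weightWord L = 1 := by
  induction L with
  | nil => simp
  | cons i L ih =>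
    rw [List.reverse_cons, weightWord_append, weightWord_cons, weightWord_cons, weightWord_nil,
      mul_one]
    have : C.weightReflection i * C.weightReflection i = 1 :=
      LinearMap.ext fun m => C.weightReflection_involutive i m
    rw [mul_assoc, ← mul_assoc (C.weightReflection i), this, one_mul, ih]

theorem sum_rootReflection_mul (i : Fin (n + 1)) (c : Fin (n + 1) → ℤ) (m : Fin (n + 1) → ℝ) :
    ∑ j, (C.rootReflection i c j : ℝ) * m j = ∑ j, (c j : ℝ) * C.weightReflection i m j := by
  have e : ∀ j, (C.rootReflection i c j : ℝ) * m j
      = c j * m j - (Pi.single i (m i * ∑ j, (C.A i j : ℝ) * c j) : Fin (n + 1) → ℝ) j := by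
    intro j
    rcases eq_or_ne j i with rfl | h
    · simp [rootReflection]; ring
    · simp [rootReflection, h]
  simp only [e, Finset.sum_sub_distrib, weightReflection_apply, mul_sub,
    Finset.sum_pi_single', Finset.mem_univ, if_true, Finset.mul_sum]
  congr 1
  refine Finset.sum_congr rfl fun j _ => by ring

theorem sum_rootWord_mul (L : List (Fin (n + 1))) (c : Fin (n + 1) → ℤ) (m : Fin (n + 1) → ℝ) :
    ∑ j, (C.rootWord L c j : ℝ) * m j = ∑ j, (c j : ℝ) * C.weightWord L m j := by
  induction L generalizing c with
  | nil => simp [rootWord]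
  | cons i L ih =>
    rw [weightWord_cons, Module.End.mul_apply, ← sum_rootReflection_mul, ← ih]
    rfl

/-- A vector of norm `2 D` with all `d_i c_i` in `D ℤ`. The real roots `c` with `(c | c) = 2 D`
have these properties, and the properties suffice to make `c` positive or negative. -/
def IsRootLike (D : ℝ) (c : Fin (n + 1) → ℤ) : Prop :=
  (∀ i, ∃ z : ℤ, C.d i * c i = D * z) ∧
    C.gram (fun i => (c i : ℝ)) (fun i => (c i : ℝ)) = 2 * D

theorem rootReflection_cast (i : Fin (n + 1)) (c : Fin (n + 1) → ℤ) :
    (fun j => (C.rootReflection i c j : ℝ))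
      = (fun j => (c j : ℝ)) - (∑ j, (C.A i j : ℝ) * c j) • (Pi.single i 1 : Fin (n + 1) → ℝ) := by
  ext j
  rcases eq_or_ne j i with rfl | h
  · simp [rootReflection]
  · simp [rootReflection, h]

theorem gram_rootReflection (i : Fin (n + 1)) (b c : Fin (n + 1) → ℤ) :
    C.gram (fun j => (C.rootReflection i b j : ℝ)) (fun j => (C.rootReflection i c j : ℝ))
      = C.gram (fun j => (b j : ℝ)) (fun j => (c j : ℝ)) := by
  simp only [rootReflection_cast, gram_sub_left, gram_sub_right, gram_smul_left, gram_smul_right]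
  rw [C.gram_comm (fun j => (b j : ℝ)) (Pi.single i 1)]
  simp only [gram_single_left]
  rw [Finset.sum_eq_single i
    (f := fun j => (C.A i j : ℝ) * (Pi.single i (1 : ℝ) : Fin (n + 1) → ℝ) j)
    (by intro j _ h; simp [h]) (by simp)]
  simp only [Pi.single_eq_same, C.diag]
  push_cast; ring

variable {C}

theorem IsRootLike.rootReflection {D : ℝ} {c : Fin (n + 1) → ℤ}
    (h : C.IsRootLike D c) (i : Fin (n + 1)) : C.IsRootLike D (C.rootReflection i c) := by
  refine ⟨fun j => ?_, by rw [gram_rootReflection, h.2]⟩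
  choose z hz using h.1
  rcases eq_or_ne j i with rfl | hj
  · refine ⟨z j - ∑ l, C.A l j * z l, ?_⟩
    have : C.d j * ∑ l, (C.A j l : ℝ) * c l = D * ∑ l, (C.A l j : ℝ) * z l := by
      rw [Finset.mul_sum, Finset.mul_sum]
      refine Finset.sum_congr rfl fun l _ => ?_
      linear_combination (c l : ℝ) * C.symm j l + (C.A l j : ℝ) * hz l
    simp only [CartanDatum.rootReflection, Pi.sub_apply, Pi.single_eq_same]
    push_cast
    rw [mul_sub, mul_sub, hz, this]
  · exact ⟨z j, by simp [CartanDatum.rootReflection, hj, hz]⟩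

theorem isRootLike_single (i : Fin (n + 1)) : C.IsRootLike (C.d i) (Pi.single i 1) := by
  have e : (fun j => ((Pi.single i 1 : Fin (n + 1) → ℤ) j : ℝ)) = Pi.single i 1 := by
    ext j
    rcases eq_or_ne j i with rfl | h
    · simp
    · simp [h]
  refine ⟨fun j => ?_, ?_⟩
  · rcases eq_or_ne j i with rfl | h
    · exact ⟨1, by simp⟩
    · exact ⟨0, by simp [h]⟩
  · rw [e, gram_single_left, Finset.sum_eq_single i (by intro j _ h; simp [h]) (by simp)]
    simp [C.diag]; ring

theorem IsRootLike.rootWord {D : ℝ} {c : Fin (n + 1) → ℤ}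
    (h : C.IsRootLike D c) (L : List (Fin (n + 1))) : C.IsRootLike D (C.rootWord L c) := by
  induction L generalizing c with
  | nil => exact h
  | cons i L ih => exact ih (h.rootReflection i)

theorem IsRootLike.nonneg_or_nonpos {D : ℝ} (hD : 0 < D) {c : Fin (n + 1) → ℤ}
    (h : C.IsRootLike D c) : (∀ i, 0 ≤ c i) ∨ (∀ i, c i ≤ 0) :=
  C.nonneg_or_nonpos hD c h.1 h.2

theorem IsRootLike.ne_zero {D : ℝ} (hD : 0 < D) {c : Fin (n + 1) → ℤ}
    (h : C.IsRootLike D c) : c ≠ 0 := by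
  rintro rfl
  have := h.2
  simp [gram] at this
  exact hD.ne' this

theorem gram_rootWord (L : List (Fin (n + 1))) (b c : Fin (n + 1) → ℤ) :
    C.gram (fun j => (C.rootWord L b j : ℝ)) (fun j => (C.rootWord L c j : ℝ))
      = C.gram (fun j => (b j : ℝ)) (fun j => (c j : ℝ)) := by
  induction L generalizing b c with
  | nil => rfl
  | cons i L ih => exact (ih _ _).trans (C.gram_rootReflection i b c)

/-- A simple reflection changes a single coefficient, so it can only turn a positive root into a
negative one if that root is a multiple of the simple root. -/
theorem eq_single_of_rootReflection_nonpos {i : Fin (n + 1)} {c : Fin (n + 1) → ℤ}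
    (hc : ∀ j, 0 ≤ c j) (hr : ∀ j, C.rootReflection i c j ≤ 0) : c = Pi.single i (c i) := by
  ext j
  rcases eq_or_ne j i with rfl | h
  · simp
  · have h1 := hr j
    have h2 := hc j
    simp only [rootReflection, Pi.sub_apply, Pi.single_eq_of_ne h, sub_zero] at h1
    rw [Pi.single_eq_of_ne h]
    omega

theorem rootReflection_involutive (i : Fin (n + 1)) (c : Fin (n + 1) → ℤ) :
    C.rootReflection i (C.rootReflection i c) = c := by
  ext j
  rcases eq_or_ne j i with rfl | h
  · simp only [rootReflection, Pi.sub_apply, Pi.single_eq_same, mul_sub, Finset.sum_sub_distrib]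
    rw [Finset.sum_eq_single j (f := fun l => C.A j l * (Pi.single j (∑ j_1, C.A j j_1 * c j_1) :
      Fin (n + 1) → ℤ) l)
      (by intro l _ h; simp [h]) (by simp)]
    simp [C.diag]; ring
  · simp [rootReflection, h]

theorem rootWord_smul (L : List (Fin (n + 1))) (t : ℤ) (c : Fin (n + 1) → ℤ) :
    C.rootWord L (t • c) = t • C.rootWord L c := by
  induction L generalizing c with
  | nil => rfl
  | cons i L ih =>
    change C.rootWord L (C.rootReflection i (t • c)) = _
    have : C.rootReflection i (t • c) = t • C.rootReflection i c := by
      ext j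
      have e : ∑ j, C.A i j * (t * c j) = t * ∑ j, C.A i j * c j := by
        rw [Finset.mul_sum]; exact Finset.sum_congr rfl fun j _ => by ring
      rcases eq_or_ne j i with rfl | h
      · simp [rootReflection, e]; ring
      · simp [rootReflection, h]
    rw [this, ih]; rfl

theorem rootWord_append (L L' : List (Fin (n + 1))) (c : Fin (n + 1) → ℤ) :
    C.rootWord (L ++ L') c = C.rootWord L' (C.rootWord L c) := by
  simp [rootWord]

theorem rootWord_reverse (L : List (Fin (n + 1))) (c : Fin (n + 1) → ℤ) :
    C.rootWord L.reverse (C.rootWord L c) = c := by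
  induction L generalizing c with
  | nil => rfl
  | cons i L ih =>
    rw [List.reverse_cons, rootWord_append]
    change C.rootReflection i (C.rootWord L.reverse (C.rootWord L (C.rootReflection i c))) = c
    rw [ih, rootReflection_involutive]

/-- A multiple of a simple root in the orbit of a simple root is primitive, as words are invertible
over the integers. -/
theorem rootWord_eq_single {L : List (Fin (n + 1))} {i j : Fin (n + 1)} {t : ℤ} (ht : 0 ≤ t)
    (h : C.rootWord L (Pi.single i 1) = Pi.single j t) : t = 1 := by
  have h1 : (Pi.single j t : Fin (n + 1) → ℤ) = t • Pi.single j 1 := by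
    rw [← Pi.single_smul]; simp
  have h2 := C.rootWord_reverse L (Pi.single i 1)
  rw [h, h1, rootWord_smul] at h2
  have h3 := congrFun h2 i
  simp only [Pi.smul_apply, smul_eq_mul, Pi.single_eq_same] at h3
  have h4 := Int.isUnit_iff.1 (IsUnit.of_mul_eq_one _ h3)
  omega

/-- If `w⁻¹ α_i = α_j`, then `s_i w = w s_j`. -/
theorem weightReflection_mul_weightWord {L : List (Fin (n + 1))} {i j : Fin (n + 1)}
    (h : C.rootWord L (Pi.single i 1) = Pi.single j 1) :
    C.weightReflection i * C.weightWord L = C.weightWord L * C.weightReflection j := by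
  have hcoord : ∀ m, C.weightWord L m i = m j := fun m => by
    have := C.sum_rootWord_mul L (Pi.single i 1) m
    rw [h] at this
    rw [Finset.sum_eq_single j (by intro l _ h; simp [h]) (by simp),
      Finset.sum_eq_single i (by intro l _ h; simp [h]) (by simp)] at this
    simpa using this.symm
  have hd : C.d i = C.d j := by
    have h1 := ((isRootLike_single (C := C) i).rootWord L).2
    rw [h, (isRootLike_single (C := C) j).2] at h1
    linarith
  have hrow : ∀ (c : Fin (n + 1) → ℤ) (l : Fin (n + 1)),
      C.gram (fun j => ((Pi.single l 1 : Fin (n + 1) → ℤ) j : ℝ)) (fun j => (c j : ℝ))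
        = C.d l * ∑ p, (c p : ℝ) * (C.A l p : ℝ) := fun c l => by
    have e : (fun j => ((Pi.single l 1 : Fin (n + 1) → ℤ) j : ℝ)) = Pi.single l 1 := by
      ext j
      rcases eq_or_ne j l with rfl | h
      · simp
      · simp [h]
    rw [e, gram_single_left]
    simp only [mul_comm]
  have hcol : C.weightWord L (fun p => (C.A j p : ℝ)) = fun p => (C.A i p : ℝ) := by
    ext l
    have h1 := C.sum_rootWord_mul L (Pi.single l 1) (fun p => (C.A j p : ℝ))
    rw [Finset.sum_eq_single (f := fun q => ((Pi.single l 1 : Fin (n + 1) → ℤ) q : ℝ)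
      * C.weightWord L (fun p => (C.A j p : ℝ)) q) l (by intro l _ h; simp [h]) (by simp)] at h1
    simp only [Pi.single_eq_same, Int.cast_one, one_mul] at h1
    rw [← h1]
    have h2 := C.gram_rootWord L (Pi.single i 1) (Pi.single l 1)
    rw [h, hrow, hrow, hd] at h2
    have h3 := mul_left_cancel₀ (C.d_pos j).ne' h2
    rw [h3, Finset.sum_eq_single l (by intro l _ h; simp [h]) (by simp)]
    simp
  refine LinearMap.ext fun m => ?_
  have e1 : ∀ (p : Fin (n + 1)) (x : Fin (n + 1) → ℝ),
      C.weightReflection p x = x - x p • (fun q => (C.A p q : ℝ)) := fun p x => by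
    ext q; simp [weightReflection_apply]
  rw [Module.End.mul_apply, Module.End.mul_apply, e1, e1, map_sub, map_smul, hcol, hcoord]

theorem sum_pos_of_nonneg {c : Fin (n + 1) → ℤ} (hc : ∀ i, 0 ≤ c i) (h0 : c ≠ 0)
    {m : Fin (n + 1) → ℝ} (hm : ∀ i, 0 < m i) : 0 < ∑ i, (c i : ℝ) * m i := by
  obtain ⟨i, hi⟩ := Function.ne_iff.1 h0
  refine Finset.sum_pos' (fun j _ => mul_nonneg (by exact_mod_cast hc j) (hm j).le)
    ⟨i, Finset.mem_univ _, mul_pos ?_ (hm i)⟩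
  exact_mod_cast lt_of_le_of_ne (hc i) (Ne.symm hi)

/-- The exchange condition. If `m` is strictly dominant and `w m` is negative on `α_i`, then
`w⁻¹ α_i` is a negative root. Let `j` be the first letter of the word `w` at which the image of
`α_i` becomes negative. Before this letter the image is `α_j`, so that moving `s_i` past the
preceding letters turns it into `s_j`. -/
theorem exists_exchange (i : Fin (n + 1)) (L : List (Fin (n + 1))) {m : Fin (n + 1) → ℝ}
    (hm : ∀ j, 0 < m j) (hneg : C.weightWord L m i < 0) :
    ∃ L₁ j L₂, L = L₁ ++ j :: L₂ ∧
      C.weightReflection i * C.weightWord L₁ = C.weightWord L₁ * C.weightReflection j := by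
  have hval : ∀ L, ∑ j, (C.rootWord L (Pi.single i 1) j : ℝ) * m j = C.weightWord L m i :=
    fun L => by
    rw [sum_rootWord_mul, Finset.sum_eq_single i (by intro l _ h; simp [h]) (by simp)]
    simp
  induction L using List.reverseRecOn with
  | nil => exact absurd hneg (by simpa using (hm i).le)
  | append_singleton L j ih =>
    have hroot := (isRootLike_single (C := C) i).rootWord L
    by_cases hL : C.weightWord L m i < 0
    · obtain ⟨L₁, p, L₂, rfl, h⟩ := ih hL
      exact ⟨L₁, p, L₂ ++ [j], by simp, h⟩
    · refine ⟨L, j, [], by simp, ?_⟩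
      have hdi := C.d_pos i
      have h1 : ∀ p, 0 ≤ C.rootWord L (Pi.single i 1) p := by
        rcases hroot.nonneg_or_nonpos hdi with h | h
        · exact h
        · exfalso
          have := sum_pos_of_nonneg (c := -C.rootWord L (Pi.single i 1))
            (fun p => by simpa using h p) (neg_ne_zero.2 (hroot.ne_zero hdi)) hm
          simp only [Pi.neg_apply, Int.cast_neg, neg_mul, Finset.sum_neg_distrib, hval] at this
          linarith
      have h2 : ∀ p, C.rootReflection j (C.rootWord L (Pi.single i 1)) p ≤ 0 := by
        have e : C.rootReflection j (C.rootWord L (Pi.single i 1))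
            = C.rootWord (L ++ [j]) (Pi.single i 1) := by rw [rootWord_append]; rfl
        rw [e]
        have hroot' := (isRootLike_single (C := C) i).rootWord (L ++ [j])
        rcases hroot'.nonneg_or_nonpos hdi with h | h
        · exfalso
          have := sum_pos_of_nonneg h (hroot'.ne_zero hdi) hm
          rw [hval] at this
          linarith
        · exact h
      have h3 := eq_single_of_rootReflection_nonpos h1 h2
      have h4 := rootWord_eq_single (h1 j) h3
      rw [h4] at h3
      exact weightReflection_mul_weightWord h3

/-- The open fundamental chamber meets its translate by a group element only if that element is the
identity. A word `s_i w` with `s_i w m` strictly dominant has `w m` negative on `α_i`; by the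
exchange condition two letters cancel, and induction on the length applies. -/
theorem weightWord_eq_one {m : Fin (n + 1) → ℝ} (hm : ∀ j, 0 < m j) :
    ∀ (L : List (Fin (n + 1))), (∀ j, 0 < C.weightWord L m j) → C.weightWord L = 1 := by
  intro L
  induction hN : L.length using Nat.strong_induction_on generalizing L with
  | _ N ih =>
    intro hL
    cases L with
    | nil => rfl
    | cons i L =>
      have h1 := hL i
      rw [weightWord_cons, Module.End.mul_apply, weightReflection_apply, C.diag] at h1
      push_cast at h1
      obtain ⟨L₁, j, L₂, rfl, h⟩ := exists_exchange (C := C) i L hm (by linarith)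
      have e : C.weightWord (i :: (L₁ ++ j :: L₂)) = C.weightWord (L₁ ++ L₂) := by
        rw [weightWord_cons, weightWord_append, weightWord_cons, ← mul_assoc, h,
          weightWord_append]
        have : C.weightReflection j * C.weightReflection j = 1 :=
          LinearMap.ext fun m => C.weightReflection_involutive j m
        rw [mul_assoc, ← mul_assoc (C.weightReflection j), this, one_mul]
      rw [e]
      rw [e] at hL
      refine ih _ ?_ (L₁ ++ L₂) rfl hL
      rw [← hN]; simp

end CartanDatum

namespace AffineType

/-! ### Labels and Cartan matrices of the affine types -/

theorem label_pos (X : AffineType) (i : ℕ) (hi : i ≤ X.rank) : 0 < X.label i := by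
  cases X <;> simp only [label, rank] at * <;>
    first | (split_ifs <;> omega) | (interval_cases i <;> simp) | simp

theorem dualLabel_pos (X : AffineType) (i : ℕ) (hi : i ≤ X.rank) : 0 < X.dualLabel i := by
  cases X <;> simp only [dualLabel, rank] at * <;>
    first | (split_ifs <;> omega) | (interval_cases i <;> simp) | simp

theorem dualLabel_zero (X : AffineType) : X.dualLabel 0 = 1 := by
  cases X <;> simp [dualLabel]

theorem label_zero_dvd_dualLabel (X : AffineType) (i : ℕ) : X.label 0 ∣ X.dualLabel (i + 1) := by
  cases X <;> simp [dualLabel, label]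
  split_ifs <;> omega

theorem cartanEntry_nonpos (X : AffineType) {i j : ℕ} (h : i ≠ j) : X.cartanEntry i j ≤ 0 := by
  cases X <;> simp only [cartanEntry, link, if_neg h] <;> split_ifs <;> omega

/-- The numbers `a_i^∨ / a_i` symmetrize the Cartan matrix; the denominators are cleared here. -/
theorem cartanEntry_symmetrizable (X : AffineType) {i j : ℕ} (hi : i ≤ X.rank) (hj : j ≤ X.rank) :
    (X.dualLabel i : ℤ) * X.cartanEntry i j * X.label j
      = X.dualLabel j * X.cartanEntry j i * X.label i := by
  rcases eq_or_ne i j with rfl | h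
  · rfl
  have h' := h.symm
  cases X <;> simp only [rank] at hi hj
  case A n hn =>
    simp [cartanEntry, link, label, dualLabel, h, h']
    grind
  case B n hn =>
    simp [cartanEntry, link, label, dualLabel, h, h']
    grind
  case C n hn =>
    simp [cartanEntry, link, label, dualLabel, h, h']
    grind
  case D n hn =>
    simp [cartanEntry, link, label, dualLabel, h, h']
    grind
  case A2even n hn =>
    simp [cartanEntry, link, label, dualLabel, h, h']
    grind
  case A2odd n hn =>
    simp [cartanEntry, link, label, dualLabel, h, h']
    grind
  case D2 n hn =>
    simp [cartanEntry, link, label, dualLabel, h, h']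
    grind
  all_goals
    clear h h'
    interval_cases i <;> interval_cases j <;> decide

/-- The Dynkin diagram is connected. -/
theorem eq_of_cartanEntry_ne_zero (X : AffineType) (f : ℕ → ℝ)
    (hf : ∀ i j, i ≤ X.rank → j ≤ X.rank → X.cartanEntry i j ≠ 0 → f i = f j) :
    ∀ i, i ≤ X.rank → f i = f 0 := by
  cases X <;> simp only [rank] at hf ⊢
  case A n hn =>
    intro i
    induction i with
    | zero => simp
    | succ i ih =>
      intro hi
      rw [← ih (by omega)]
      apply hf _ _ hi (by omega)
      simp [cartanEntry, link] <;> grind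
  case B n hn =>
    have h1 : f 1 = f 2 := hf _ _ (by omega) (by omega) (by simp [cartanEntry, link] <;> grind)
    have h0 : f 0 = f 2 := hf _ _ (by omega) (by omega) (by simp [cartanEntry, link] <;> grind)
    intro i
    induction i with
    | zero => simp
    | succ i ih =>
      intro hi
      rcases Nat.eq_zero_or_pos i with rfl | h
      · simp [h1, h0]
      rw [← ih (by omega)]
      apply hf _ _ hi (by omega)
      simp [cartanEntry, link] <;> grind
  case C n hn =>
    intro i
    induction i with
    | zero => simp
    | succ i ih =>
      intro hi
      rw [← ih (by omega)]
      apply hf _ _ hi (by omega)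
      simp [cartanEntry, link] <;> grind
  case D n hn =>
    have h1 : f 1 = f 2 := hf _ _ (by omega) (by omega) (by simp [cartanEntry, link] <;> grind)
    have h0 : f 0 = f 2 := hf _ _ (by omega) (by omega) (by simp [cartanEntry, link])
    have key : ∀ i, i + 1 ≤ n → f i = f 0 := by
      intro i
      induction i with
      | zero => simp
      | succ i ih =>
        intro hi
        rcases Nat.eq_zero_or_pos i with rfl | h
        · simp [h1, h0]
        rw [← ih (by omega)]
        apply hf _ _ (by omega) (by omega)
        simp [cartanEntry, link] <;> grind
    intro i hi
    rcases Nat.lt_or_ge i n with h | h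
    · exact key i h
    · rw [← key (n - 2) (by omega)]
      apply hf _ _ (by omega) (by omega)
      simp [cartanEntry, link] <;> grind
  case A2even n hn =>
    intro i
    induction i with
    | zero => simp
    | succ i ih =>
      intro hi
      rw [← ih (by omega)]
      apply hf _ _ hi (by omega)
      simp [cartanEntry, link] <;> grind
  case A2odd n hn =>
    have h1 : f 1 = f 2 := hf _ _ (by omega) (by omega) (by simp [cartanEntry, link] <;> grind)
    have h0 : f 0 = f 2 := hf _ _ (by omega) (by omega) (by simp [cartanEntry, link] <;> grind)
    intro i
    induction i with
    | zero => simp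
    | succ i ih =>
      intro hi
      rcases Nat.eq_zero_or_pos i with rfl | h
      · simp [h1, h0]
      rw [← ih (by omega)]
      apply hf _ _ hi (by omega)
      simp [cartanEntry, link] <;> grind
  case D2 n hn =>
    intro i
    induction i with
    | zero => simp
    | succ i ih =>
      intro hi
      rw [← ih (by omega)]
      apply hf _ _ hi (by omega)
      simp [cartanEntry, link] <;> grind
  case E6 =>
    have a := hf 0 6 (by decide) (by decide) (by decide)
    have a := hf 6 3 (by decide) (by decide) (by decide)
    have a := hf 3 2 (by decide) (by decide) (by decide)
    have a := hf 2 1 (by decide) (by decide) (by decide)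
    have a := hf 3 4 (by decide) (by decide) (by decide)
    have a := hf 4 5 (by decide) (by decide) (by decide)
    intro i hi; interval_cases i <;> grind
  case E7 =>
    have a := hf 0 1 (by decide) (by decide) (by decide)
    have a := hf 1 2 (by decide) (by decide) (by decide)
    have a := hf 2 3 (by decide) (by decide) (by decide)
    have a := hf 3 4 (by decide) (by decide) (by decide)
    have a := hf 4 5 (by decide) (by decide) (by decide)
    have a := hf 5 6 (by decide) (by decide) (by decide)
    have a := hf 3 7 (by decide) (by decide) (by decide)
    intro i hi; interval_cases i <;> grind
  case E8 =>
    have a := hf 0 1 (by decide) (by decide) (by decide)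
    have a := hf 1 2 (by decide) (by decide) (by decide)
    have a := hf 2 3 (by decide) (by decide) (by decide)
    have a := hf 3 4 (by decide) (by decide) (by decide)
    have a := hf 4 5 (by decide) (by decide) (by decide)
    have a := hf 5 6 (by decide) (by decide) (by decide)
    have a := hf 6 7 (by decide) (by decide) (by decide)
    have a := hf 5 8 (by decide) (by decide) (by decide)
    intro i hi; interval_cases i <;> grind
  case G2 =>
    have a := hf 0 1 (by decide) (by decide) (by decide)
    have a := hf 1 2 (by decide) (by decide) (by decide)
    intro i hi; interval_cases i <;> grind
  case D43 =>
    have a := hf 0 1 (by decide) (by decide) (by decide)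
    have a := hf 1 2 (by decide) (by decide) (by decide)
    intro i hi; interval_cases i <;> grind
  all_goals
    have a := hf 0 1 (by decide) (by decide) (by decide)
    have a := hf 1 2 (by decide) (by decide) (by decide)
    have a := hf 2 3 (by decide) (by decide) (by decide)
    have a := hf 3 4 (by decide) (by decide) (by decide)
    intro i hi; interval_cases i <;> grind
/-! ### The labels as a null vector -/

theorem sum_range_eq_sum_finset {N : ℕ} (f : ℕ → ℤ) (T : Finset ℕ) (hT : ∀ j ∈ T, j < N)
    (h : ∀ j, j < N → j ∉ T → f j = 0) : ∑ j ∈ Finset.range N, f j = ∑ j ∈ T, f j := by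
  refine (Finset.sum_subset (fun j hj => Finset.mem_range.2 (hT j hj)) fun j hj hj' => ?_).symm
  exact h j (Finset.mem_range.1 hj) hj'

theorem sum_range_eq_two {N : ℕ} (f : ℕ → ℤ) {p q : ℕ} (hpq : p < q) (hq : q < N)
    (h : ∀ j, j < N → j ≠ p → j ≠ q → f j = 0) : ∑ j ∈ Finset.range N, f j = f p + f q := by
  rw [sum_range_eq_sum_finset f {p, q} (by simp; omega) (by simp; grind),
    Finset.sum_pair hpq.ne]

theorem sum_range_eq_three {N : ℕ} (f : ℕ → ℤ) {p q r : ℕ} (hpq : p < q) (hqr : q < r) (hr : r < N)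
    (h : ∀ j, j < N → j ≠ p → j ≠ q → j ≠ r → f j = 0) :
    ∑ j ∈ Finset.range N, f j = f p + f q + f r := by
  rw [sum_range_eq_sum_finset f {p, q, r} (by simp; omega) (by simp; grind),
    Finset.sum_insert (by simp; omega), Finset.sum_pair hqr.ne, add_assoc]

theorem sum_range_eq_four {N : ℕ} (f : ℕ → ℤ) {p q r s : ℕ} (hpq : p < q) (hqr : q < r)
    (hrs : r < s) (hs : s < N)
    (h : ∀ j, j < N → j ≠ p → j ≠ q → j ≠ r → j ≠ s → f j = 0) :
    ∑ j ∈ Finset.range N, f j = f p + f q + f r + f s := by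
  rw [sum_range_eq_sum_finset f {p, q, r, s} (by simp; omega) (by simp; grind),
    Finset.sum_insert (by simp; omega), Finset.sum_insert (by simp; omega),
    Finset.sum_pair hrs.ne, ← add_assoc, ← add_assoc]

theorem sum_cartanEntry_mul_label (X : AffineType) {i : ℕ} (hi : i ≤ X.rank) :
    ∑ j ∈ Finset.range (X.rank + 1), X.cartanEntry i j * X.label j = 0 := by
  cases X
  case A n hn =>
    simp only [rank] at hi ⊢
    rcases eq_or_ne n 1 with rfl | h1
    · interval_cases i <;> decide +revert
    rcases eq_or_ne i 0 with rfl | h0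
    · rw [sum_range_eq_three (p := 0) (q := 1) (r := n)] <;>
        (try simp [cartanEntry, link, label]) <;> grind
    rcases eq_or_ne i n with rfl | h2
    · rw [sum_range_eq_three (p := 0) (q := i - 1) (r := i)] <;>
        (try simp [cartanEntry, link, label]) <;> grind
    · rw [sum_range_eq_three (p := i - 1) (q := i) (r := i + 1)] <;>
        (try simp [cartanEntry, link, label]) <;> grind
  case B n hn =>
    simp only [rank] at hi ⊢
    rcases eq_or_ne i 0 with rfl | h0
    · rw [sum_range_eq_two (p := 0) (q := 2)] <;>
        (try simp [cartanEntry, link, label]) <;> grind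
    rcases eq_or_ne i 1 with rfl | h1
    · rw [sum_range_eq_two (p := 1) (q := 2)] <;>
        (try simp [cartanEntry, link, label]) <;> grind
    rcases eq_or_ne i 2 with rfl | h2
    · rw [sum_range_eq_four (p := 0) (q := 1) (r := 2) (s := 3)] <;>
        (try simp [cartanEntry, link, label]) <;> grind
    rcases eq_or_ne i n with rfl | h2
    · rw [sum_range_eq_two (p := i - 1) (q := i)] <;>
        (try simp [cartanEntry, link, label]) <;> grind
    · rw [sum_range_eq_three (p := i - 1) (q := i) (r := i + 1)] <;>
        (try simp [cartanEntry, link, label]) <;> grind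
  case C n hn =>
    simp only [rank] at hi ⊢
    rcases eq_or_ne i 0 with rfl | h0
    · rw [sum_range_eq_two (p := 0) (q := 1)] <;>
        (try simp [cartanEntry, link, label]) <;> grind
    rcases eq_or_ne i n with rfl | h2
    · rw [sum_range_eq_two (p := i - 1) (q := i)] <;>
        (try simp [cartanEntry, link, label]) <;> grind
    · rw [sum_range_eq_three (p := i - 1) (q := i) (r := i + 1)] <;>
        (try simp [cartanEntry, link, label]) <;> grind
  case D n hn =>
    simp only [rank] at hi ⊢
    rcases eq_or_ne n 4 with rfl | h4
    · interval_cases i <;> decide +revert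
    rcases eq_or_ne i 0 with rfl | h0
    · rw [sum_range_eq_two (p := 0) (q := 2)] <;>
        (try simp [cartanEntry, link, label]) <;> grind
    rcases eq_or_ne i 1 with rfl | h1
    · rw [sum_range_eq_two (p := 1) (q := 2)] <;>
        (try simp [cartanEntry, link, label]) <;> grind
    rcases eq_or_ne i 2 with rfl | h2
    · rw [sum_range_eq_four (p := 0) (q := 1) (r := 2) (s := 3)] <;>
        (try simp [cartanEntry, link, label]) <;> grind
    rcases eq_or_ne i n with rfl | h2
    · rw [sum_range_eq_two (p := i - 2) (q := i)] <;>
        (try simp [cartanEntry, link, label]) <;> grind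
    rcases eq_or_ne (i + 1) n with rfl | h2
    · rw [sum_range_eq_two (p := i - 1) (q := i)] <;>
        (try simp [cartanEntry, link, label]) <;> grind
    rcases eq_or_ne (i + 2) n with rfl | h2
    · rw [sum_range_eq_four (p := i - 1) (q := i) (r := i + 1) (s := i + 2)] <;>
        (try simp [cartanEntry, link, label]) <;> grind
    · rw [sum_range_eq_three (p := i - 1) (q := i) (r := i + 1)] <;>
        (try simp [cartanEntry, link, label]) <;> grind
  case A2even n hn =>
    simp only [rank] at hi ⊢
    rcases eq_or_ne n 1 with rfl | h1
    · interval_cases i <;> decide +revert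
    rcases eq_or_ne i 0 with rfl | h0
    · rw [sum_range_eq_two (p := 0) (q := 1)] <;>
        (try simp [cartanEntry, link, label]) <;> grind
    rcases eq_or_ne i n with rfl | h2
    · rw [sum_range_eq_two (p := i - 1) (q := i)] <;>
        (try simp [cartanEntry, link, label]) <;> grind
    · rw [sum_range_eq_three (p := i - 1) (q := i) (r := i + 1)] <;>
        (try simp [cartanEntry, link, label]) <;> grind
  case A2odd n hn =>
    simp only [rank] at hi ⊢
    rcases eq_or_ne i 0 with rfl | h0
    · rw [sum_range_eq_two (p := 0) (q := 2)] <;>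
        (try simp [cartanEntry, link, label]) <;> grind
    rcases eq_or_ne i 1 with rfl | h1
    · rw [sum_range_eq_two (p := 1) (q := 2)] <;>
        (try simp [cartanEntry, link, label]) <;> grind
    rcases eq_or_ne i 2 with rfl | h2
    · rw [sum_range_eq_four (p := 0) (q := 1) (r := 2) (s := 3)] <;>
        (try simp [cartanEntry, link, label]) <;> grind
    rcases eq_or_ne i n with rfl | h2
    · rw [sum_range_eq_two (p := i - 1) (q := i)] <;>
        (try simp [cartanEntry, link, label]) <;> grind
    · rw [sum_range_eq_three (p := i - 1) (q := i) (r := i + 1)] <;>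
        (try simp [cartanEntry, link, label]) <;> grind
  case D2 n hn =>
    simp only [rank] at hi ⊢
    rcases eq_or_ne i 0 with rfl | h0
    · rw [sum_range_eq_two (p := 0) (q := 1)] <;>
        (try simp [cartanEntry, link, label]) <;> grind
    rcases eq_or_ne i n with rfl | h2
    · rw [sum_range_eq_two (p := i - 1) (q := i)] <;>
        (try simp [cartanEntry, link, label]) <;> grind
    · rw [sum_range_eq_three (p := i - 1) (q := i) (r := i + 1)] <;>
        (try simp [cartanEntry, link, label]) <;> grind
  all_goals
    simp only [rank] at hi
    interval_cases i <;> decide +revert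

/-! ### Induction over the vertices, and the highest root -/

/-- Induction over the vertices of the finite diagram, for `r ≤ a_0`. The three rules are those by
which the lattice `M` is seen to contain the vectors `(a_j / a_j^∨) α_j`. -/
theorem coroot_vertex_induction (X : AffineType) (hX : X.r ≤ X.label 0) (Q : ℕ → Prop)
    (start : ∀ j, 1 ≤ j → j ≤ X.rank → X.cartanEntry 0 j = -X.label 0 → Q j)
    (step : ∀ i j, 1 ≤ i → i ≤ X.rank → 1 ≤ j → j ≤ X.rank → X.cartanEntry i j = -1 → Q i → Q j)
    (last : ∀ m, 1 ≤ m → m ≤ X.rank → X.dualLabel m = X.label 0 →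
      (∀ j, 1 ≤ j → j ≤ X.rank → j ≠ m → Q j) → Q m) :
    ∀ j, 1 ≤ j → j ≤ X.rank → Q j := by
  cases X <;> simp only [rank, r] at hX start step last ⊢
  case A n hn =>
    rcases eq_or_ne n 1 with rfl | h1
    · intro j h1 h2
      refine last j h1 h2 (by simp [label, dualLabel]) (by grind)
    intro j hj
    induction j, hj using Nat.le_induction with
    | base => intro h; exact start 1 le_rfl h (by simp [cartanEntry, link, label]; grind)
    | succ j hj ih =>
      intro h
      exact step j _ hj (by omega) (by omega) h (by simp [cartanEntry, link]; grind) (ih (by omega))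
  case B n hn =>
    have h2 : Q 2 := start 2 (by omega) (by omega) (by simp [cartanEntry, link, label]; grind)
    have h1 : Q 1 := step 2 1 (by omega) (by omega) (by omega) (by omega)
      (by simp [cartanEntry, link]; grind) h2
    intro j hj
    induction j, hj using Nat.le_induction with
    | base => intro h; exact h1
    | succ j hj ih =>
      intro h
      exact step j _ hj (by omega) (by omega) h (by simp [cartanEntry, link]; grind) (ih (by omega))
  case C n hn =>
    have key : ∀ j, 1 ≤ j → j < n → Q j := by
      intro j hj
      induction j, hj using Nat.le_induction with
      | base => intro h; exact start 1 le_rfl h.le (by simp [cartanEntry, link, label]; grind)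
      | succ j hj ih =>
        intro h
        exact step j _ hj (by omega) (by omega) h.le (by simp [cartanEntry, link]; grind)
          (ih (by omega))
    intro j hj h
    rcases h.lt_or_eq with h | rfl
    · exact key j hj h
    · exact last j hj h (by simp [label, dualLabel]) (fun p h1 h2 h3 => key p h1 (by omega))
  case D n hn =>
    have h2 : Q 2 := start 2 (by omega) (by omega) (by simp [cartanEntry, link, label])
    have h1 : Q 1 := step 2 1 (by omega) (by omega) (by omega) (by omega)
      (by simp [cartanEntry, link]; grind) h2
    have key : ∀ j, 1 ≤ j → j < n → Q j := by
      intro j hj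
      induction j, hj using Nat.le_induction with
      | base => intro h; exact h1
      | succ j hj ih =>
        intro h
        exact step j _ hj (by omega) (by omega) h.le (by simp [cartanEntry, link]; grind)
          (ih (by omega))
    intro j hj h
    rcases h.lt_or_eq with h | rfl
    · exact key j hj h
    · exact step (j - 2) j (by omega) (by omega) (by omega) (by omega)
        (by simp [cartanEntry, link]; grind) (key _ (by omega) (by omega))
  case A2even n hn =>
    have key : ∀ j, 1 ≤ j → j < n → Q j := by
      intro j hj
      induction j, hj using Nat.le_induction with
      | base => intro h; exact start 1 le_rfl h.le (by simp [cartanEntry, link, label]; grind)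
      | succ j hj ih =>
        intro h
        exact step j _ hj (by omega) (by omega) h.le (by simp [cartanEntry, link]; grind)
          (ih (by omega))
    intro j hj h
    rcases h.lt_or_eq with h | rfl
    · exact key j hj h
    · exact last j hj h (by simp [label, dualLabel]; grind) (fun p h1 h2 h3 => key p h1 (by omega))
  case E6 =>
    have h6 := start 6 (by decide) (by decide) (by decide)
    have h3 := step 6 3 (by decide) (by decide) (by decide) (by decide) (by decide) h6
    have h2 := step 3 2 (by decide) (by decide) (by decide) (by decide) (by decide) h3
    have h1 := step 2 1 (by decide) (by decide) (by decide) (by decide) (by decide) h2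
    have h4 := step 3 4 (by decide) (by decide) (by decide) (by decide) (by decide) h3
    have h5 := step 4 5 (by decide) (by decide) (by decide) (by decide) (by decide) h4
    intro j h h'; interval_cases j <;> assumption
  case E7 =>
    have h1 := start 1 (by decide) (by decide) (by decide)
    have h2 := step 1 2 (by decide) (by decide) (by decide) (by decide) (by decide) h1
    have h3 := step 2 3 (by decide) (by decide) (by decide) (by decide) (by decide) h2
    have h4 := step 3 4 (by decide) (by decide) (by decide) (by decide) (by decide) h3
    have h5 := step 4 5 (by decide) (by decide) (by decide) (by decide) (by decide) h4
    have h6 := step 5 6 (by decide) (by decide) (by decide) (by decide) (by decide) h5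
    have h7 := step 3 7 (by decide) (by decide) (by decide) (by decide) (by decide) h3
    intro j h h'; interval_cases j <;> assumption
  case E8 =>
    have h1 := start 1 (by decide) (by decide) (by decide)
    have h2 := step 1 2 (by decide) (by decide) (by decide) (by decide) (by decide) h1
    have h3 := step 2 3 (by decide) (by decide) (by decide) (by decide) (by decide) h2
    have h4 := step 3 4 (by decide) (by decide) (by decide) (by decide) (by decide) h3
    have h5 := step 4 5 (by decide) (by decide) (by decide) (by decide) (by decide) h4
    have h6 := step 5 6 (by decide) (by decide) (by decide) (by decide) (by decide) h5
    have h7 := step 6 7 (by decide) (by decide) (by decide) (by decide) (by decide) h6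
    have h8 := step 5 8 (by decide) (by decide) (by decide) (by decide) (by decide) h5
    intro j h h'; interval_cases j <;> assumption
  case F4 =>
    have h1 := start 1 (by decide) (by decide) (by decide)
    have h2 := step 1 2 (by decide) (by decide) (by decide) (by decide) (by decide) h1
    have h3 := step 2 3 (by decide) (by decide) (by decide) (by decide) (by decide) h2
    have h4 := step 3 4 (by decide) (by decide) (by decide) (by decide) (by decide) h3
    intro j h h'; interval_cases j <;> assumption
  case G2 =>
    have h1 := start 1 (by decide) (by decide) (by decide)
    have h2 := step 1 2 (by decide) (by decide) (by decide) (by decide) (by decide) h1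
    intro j h h'; interval_cases j <;> assumption
  all_goals simp [label] at hX

/-- Induction over the vertices of the finite diagram, for `r > a_0`. The three rules are those by
which the lattice `M` is seen to contain the simple roots `α_j`. -/
theorem root_vertex_induction (X : AffineType) (hX : X.label 0 < X.r) (Q : ℕ → Prop)
    (start : ∀ j, 1 ≤ j → j ≤ X.rank → X.cartanEntry j 0 = -1 → Q j)
    (step : ∀ i j, 1 ≤ i → i ≤ X.rank → 1 ≤ j → j ≤ X.rank → X.cartanEntry j i = -1 → Q i → Q j)
    (last : ∀ m, 1 ≤ m → m ≤ X.rank → X.label m = 1 →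
      (∀ j, 1 ≤ j → j ≤ X.rank → j ≠ m → Q j) → Q m) :
    ∀ j, 1 ≤ j → j ≤ X.rank → Q j := by
  cases X <;> simp only [rank, r] at hX start step last ⊢
  case A2odd n hn =>
    have h2 : Q 2 := start 2 (by omega) (by omega) (by simp [cartanEntry, link]; grind)
    have h1 : Q 1 := step 2 1 (by omega) (by omega) (by omega) (by omega)
      (by simp [cartanEntry, link]; grind) h2
    intro j hj
    induction j, hj using Nat.le_induction with
    | base => intro h; exact h1
    | succ j hj ih =>
      intro h
      exact step j _ hj (by omega) (by omega) h (by simp [cartanEntry, link]; grind) (ih (by omega))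
  case D2 n hn =>
    have key : ∀ j, 1 ≤ j → j < n → Q j := by
      intro j hj
      induction j, hj using Nat.le_induction with
      | base => intro h; exact start 1 le_rfl h.le (by simp [cartanEntry, link]; grind)
      | succ j hj ih =>
        intro h
        exact step j _ hj (by omega) (by omega) h.le (by simp [cartanEntry, link]; grind)
          (ih (by omega))
    intro j hj h
    rcases h.lt_or_eq with h | rfl
    · exact key j hj h
    · exact last j hj h (by simp [label]) (fun p h1 h2 h3 => key p h1 (by omega))
  case E62 =>
    have h1 := start 1 (by decide) (by decide) (by decide)
    have h2 := step 1 2 (by decide) (by decide) (by decide) (by decide) (by decide) h1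
    have h3 := step 2 3 (by decide) (by decide) (by decide) (by decide) (by decide) h2
    have h4 := step 3 4 (by decide) (by decide) (by decide) (by decide) (by decide) h3
    intro j h h'; interval_cases j <;> assumption
  case D43 =>
    have h1 := start 1 (by decide) (by decide) (by decide)
    have h2 := step 1 2 (by decide) (by decide) (by decide) (by decide) (by decide) h1
    intro j h h'; interval_cases j <;> assumption
  all_goals (simp [label] at hX <;> (split_ifs at hX <;> omega))

theorem exists_perm_of_swap {N p q : ℕ} (hp : p < N) (hq : q < N) {c a : ℕ → ℕ}
    (h1 : c p = a q) (h2 : c q = a p) (h : ∀ i, i ≠ p → i ≠ q → c i = a i) :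
    ∃ σ : Equiv.Perm (Fin N), ∀ i : Fin N, c i = a (σ i) := by
  refine ⟨Equiv.swap ⟨p, hp⟩ ⟨q, hq⟩, fun i => ?_⟩
  rcases eq_or_ne i ⟨p, hp⟩ with rfl | hip
  · rw [Equiv.swap_apply_left]; exact h1
  rcases eq_or_ne i ⟨q, hq⟩ with rfl | hiq
  · rw [Equiv.swap_apply_right]; exact h2
  · rw [Equiv.swap_apply_of_ne_of_ne hip hiq]
    exact h i (fun h => hip (Fin.ext h)) (fun h => hiq (Fin.ext h))

/-- If `r > a_0`, the levels of the fundamental coweights are a rearrangement of the dual labels.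
In each of the four families this is achieved by exchanging two vertices. -/
theorem exists_perm_coweightLabel (X : AffineType) (hX : X.label 0 < X.r) :
    ∃ σ : Equiv.Perm (Fin (X.rank + 1)), ∀ i : Fin (X.rank + 1),
      X.coweightLabel i = X.dualLabel (σ i) := by
  cases X <;> simp only [rank, r] at hX ⊢
  case A2odd n hn =>
    refine exists_perm_of_swap (p := 1) (q := n) (by omega) (by omega) ?_ ?_ ?_ <;>
      simp [coweightLabel, dualLabel] <;> grind
  case D2 n hn =>
    refine exists_perm_of_swap (p := 1) (q := n) (by omega) (by omega) ?_ ?_ ?_ <;>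
      simp [coweightLabel, dualLabel] <;> grind
  case E62 =>
    refine exists_perm_of_swap (p := 2) (q := 3) (by decide) (by decide) rfl rfl fun i h1 h2 => ?_
    rcases i with _ | _ | _ | _ | _ | i <;> simp [coweightLabel, dualLabel] at h1 h2 ⊢
  case D43 =>
    refine exists_perm_of_swap (p := 1) (q := 2) (by decide) (by decide) rfl rfl fun i h1 h2 => ?_
    rcases i with _ | _ | _ | i <;> simp [coweightLabel, dualLabel] at h1 h2 ⊢
  all_goals (simp [label] at hX <;> (split_ifs at hX <;> omega))

theorem coweightLabel_eq_label (X : AffineType) (hX : X.r ≤ X.label 0) (i : ℕ) :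
    X.coweightLabel (i + 1) = X.label (i + 1) := by
  cases X <;> simp [r, label, coweightLabel] at hX ⊢

/-- If `r > a_0`, the highest root `η = ∑ i ≥ 1, c_i α_i` satisfies `(a_i^∨ / a_i) c_i = r z_i`
with integers `z_i`, and `∑ i ≥ 1, z_i ⟨α_i^∨, η⟩ = 2`. Hence `(η | η) = 2 r`, and
`∑ i ≥ 1, z_i α_i^∨` is the coroot of `η`. The sums run over all vertices, with zero summands at
the vertex `0`. -/
theorem exists_highRoot_corootCoeff (X : AffineType) (hX : X.label 0 < X.r) : ∃ z : ℕ → ℕ,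
    (∀ i, 1 ≤ i → i ≤ X.rank →
      X.dualLabel i * X.coweightLabel i = X.r * X.label i * z i) ∧
    ∑ i ∈ Finset.range (X.rank + 1), (if i = 0 then 0 else (z i : ℤ)) *
      ∑ j ∈ Finset.range (X.rank + 1), X.cartanEntry i j *
        (if j = 0 then 0 else (X.coweightLabel j : ℤ)) = 2 := by
  cases X <;> simp only [rank, r] at hX ⊢
  case A2odd n hn =>
    refine ⟨fun _ => 1, fun i _ _ => by simp [dualLabel, coweightLabel, label]; grind, ?_⟩
    rw [Finset.sum_eq_single 1]
    · rw [sum_range_eq_two (p := 1) (q := 2)] <;>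
        (try simp [cartanEntry, link, coweightLabel]) <;> grind
    · intro i hi h1
      rcases eq_or_ne i 0 with rfl | h0
      · simp
      rw [Finset.mem_range] at hi
      rcases eq_or_ne i n with rfl | h2
      · rw [sum_range_eq_two (p := i - 1) (q := i)] <;>
          (try simp [cartanEntry, link, coweightLabel]) <;> grind
      · rw [sum_range_eq_three (p := i - 1) (q := i) (r := i + 1)] <;>
          (try simp [cartanEntry, link, coweightLabel]) <;> grind
    · intro h; simp at h; omega
  case D2 n hn =>
    refine ⟨fun i => if i = 1 ∨ i = n then 1 else 2,
      fun i _ _ => by simp [dualLabel, coweightLabel, label]; grind, ?_⟩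
    rw [Finset.sum_eq_single 2]
    · rcases eq_or_ne n 2 with rfl | h2
      · rw [sum_range_eq_two (p := 1) (q := 2)] <;>
          (try simp [cartanEntry, link, coweightLabel]) <;> grind
      · rw [sum_range_eq_three (p := 1) (q := 2) (r := 3)] <;>
          (try simp [cartanEntry, link, coweightLabel]) <;> grind
    · intro i hi h1
      rcases eq_or_ne i 0 with rfl | h0
      · simp
      rw [Finset.mem_range] at hi
      rcases eq_or_ne i n with rfl | h2
      · rw [sum_range_eq_two (p := i - 1) (q := i)] <;>
          (try simp [cartanEntry, link, coweightLabel]) <;> grind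
      rcases eq_or_ne i 1 with rfl | h3
      · rw [sum_range_eq_two (p := 1) (q := 2)] <;>
          (try simp [cartanEntry, link, coweightLabel]) <;> grind
      · rw [sum_range_eq_three (p := i - 1) (q := i) (r := i + 1)] <;>
          (try simp [cartanEntry, link, coweightLabel]) <;> grind
    · intro h; simp at h; omega
  case E62 =>
    refine ⟨fun i => [0, 1, 2, 3, 2].getD i 0, fun i h h' => ?_, by decide⟩
    interval_cases i <;> decide
  case D43 =>
    refine ⟨fun i => [0, 1, 2].getD i 0, fun i h h' => ?_, by decide⟩
    interval_cases i <;> decide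
  all_goals (simp [label] at hX <;> (split_ifs at hX <;> omega))

noncomputable section

/-! ### The normalized invariant form -/

/-- The Cartan matrix of `X`, with the symmetrizer `a_i^∨ / a_i` and the null vector of the labels.
-/
def datum (X : AffineType) : CartanDatum X.rank where
  A i j := X.cartanEntry i j
  d i := (X.dualLabel i : ℝ) / X.label i
  u i := X.label i
  d_pos i := div_pos (by exact_mod_cast X.dualLabel_pos i (Nat.lt_succ_iff.1 i.2))
    (by exact_mod_cast X.label_pos i (Nat.lt_succ_iff.1 i.2))
  u_pos i := by exact_mod_cast X.label_pos i (Nat.lt_succ_iff.1 i.2)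
  diag i := X.cartanEntry_self i
  offdiag i j h := X.cartanEntry_nonpos (fun h' => h (Fin.ext h'))
  symm i j := by
    have h := X.cartanEntry_symmetrizable (Nat.lt_succ_iff.1 i.2) (Nat.lt_succ_iff.1 j.2)
    have h' : (X.dualLabel i : ℝ) * X.cartanEntry i j * X.label j
      = X.dualLabel j * X.cartanEntry j i * X.label i := by exact_mod_cast h
    have hi : (X.label i : ℝ) ≠ 0 := by
      exact_mod_cast (X.label_pos i (Nat.lt_succ_iff.1 i.2)).ne'
    have hj : (X.label j : ℝ) ≠ 0 := by
      exact_mod_cast (X.label_pos j (Nat.lt_succ_iff.1 j.2)).ne'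
    field_simp
    linarith
  null i := by
    have h := X.sum_cartanEntry_mul_label (Nat.lt_succ_iff.1 i.2)
    rw [← Fin.sum_univ_eq_sum_range (fun j => X.cartanEntry i j * (X.label j : ℤ))] at h
    exact_mod_cast h
  conn f hf i j := by
    have h := X.eq_of_cartanEntry_ne_zero (fun p => if hp : p < X.rank + 1 then f ⟨p, hp⟩ else 0)
      (fun p q hp hq h => by
        simp only [Nat.lt_succ_iff, hp, hq, dif_pos]
        exact hf _ _ h)
    have h1 := h i (Nat.lt_succ_iff.1 i.2)
    have h2 := h j (Nat.lt_succ_iff.1 j.2)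
    simp only [i.2, j.2, dif_pos] at h1 h2
    exact h1.trans h2.symm

/-- The number `a_i^∨ / a_i` at the vertex `i + 1`, half the squared length of the simple root. -/
def ratio (X : AffineType) (i : Fin X.rank) : ℝ := (X.dualLabel (i + 1) : ℝ) / X.label (i + 1)

theorem datum_d_succ (X : AffineType) (i : Fin X.rank) : X.datum.d i.succ = X.ratio i := by
  simp [datum, ratio]

theorem ratio_pos (X : AffineType) (i : Fin X.rank) : 0 < X.ratio i := by
  rw [← datum_d_succ]; exact X.datum.d_pos _

theorem label_ne_zero (X : AffineType) (i : Fin X.rank) : (X.label (i + 1) : ℝ) ≠ 0 := by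
  exact_mod_cast (X.label_pos (i + 1) (by omega)).ne'

theorem dualLabel_ne_zero (X : AffineType) (i : Fin X.rank) : (X.dualLabel (i + 1) : ℝ) ≠ 0 := by
  exact_mod_cast (X.dualLabel_pos (i + 1) (by omega)).ne'

theorem label_zero_pos (X : AffineType) : (0 : ℝ) < X.label 0 := by
  exact_mod_cast X.label_pos 0 (by omega)

theorem ratio_mul_finiteCartan (X : AffineType) (i j : Fin X.rank) :
    X.ratio i * X.finiteCartan i j = X.ratio j * X.finiteCartan j i := by
  have := X.datum.symm i.succ j.succ
  simpa [datum_d_succ, datum, finiteCartan, ratio] using this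

/-- The vector `∑ b_j α_j` of the finite-dimensional space. -/
def rootVec (X : AffineType) (b : Fin X.rank → ℝ) : X.Space := X.finiteCartan.mulVec b

theorem rootVec_apply (X : AffineType) (b : Fin X.rank → ℝ) (i : Fin X.rank) :
    X.rootVec b i = ∑ j, X.finiteCartan i j * b j := rfl

/-- A vector of coefficients on the vertices `1, …, n`, extended by zero to the vertex `0`. -/
def extend {n : ℕ} (b : Fin n → ℝ) : Fin (n + 1) → ℝ := Fin.cons 0 b

theorem gram_extend (X : AffineType) (b c : Fin X.rank → ℝ) :
    X.datum.gram (extend b) (extend c) = ∑ i, b i * (X.ratio i * X.rootVec c i) := by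
  rw [CartanDatum.gram_eq_sum_left, Fin.sum_univ_succ]
  simp only [extend, Fin.cons_zero, zero_mul, zero_add, Fin.cons_succ, datum_d_succ,
    Fin.sum_univ_succ, mul_zero, rootVec_apply]
  simp [datum, finiteCartan]

/-- The form is definite on the span of `α_1, …, α_n`, as no nonzero multiple of the null vector
vanishes at the vertex `0`. -/
theorem gram_extend_self_eq_zero (X : AffineType) {b : Fin X.rank → ℝ}
    (h : X.datum.gram (extend b) (extend b) = 0) : b = 0 := by
  obtain ⟨t, ht⟩ := X.datum.eq_smul_of_gram_self_eq_zero h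
  have h0 := congrFun ht 0
  simp only [extend, Fin.cons_zero, Pi.smul_apply, smul_eq_mul, zero_eq_mul,
    (X.datum.u_pos 0).ne', or_false] at h0
  ext i
  have := congrFun ht i.succ
  simpa [h0, extend] using this

theorem isUnit_det_finiteCartan (X : AffineType) : IsUnit X.finiteCartan.det := by
  rw [isUnit_iff_ne_zero]
  intro h
  obtain ⟨b, hb, h0⟩ := Matrix.exists_mulVec_eq_zero_iff.2 h
  apply hb
  apply X.gram_extend_self_eq_zero
  have : X.rootVec b = 0 := h0
  rw [gram_extend, this]
  simp

theorem exists_eq_rootVec (X : AffineType) (x : X.Space) : ∃ b, x = X.rootVec b := by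
  refine ⟨X.finiteCartan⁻¹.mulVec x, ?_⟩
  rw [rootVec, Matrix.mulVec_mulVec, Matrix.mul_nonsing_inv _ X.isUnit_det_finiteCartan,
    Matrix.one_mulVec]

theorem form_rootVec (X : AffineType) (b : Fin X.rank → ℝ) (y : X.Space) :
    X.form (X.rootVec b) y = ∑ i, b i * (X.ratio i * y i) := by
  rw [form, Matrix.toLinearMap₂'_apply', ← Matrix.mulVec_mulVec, Matrix.dotProduct_mulVec,
    Matrix.vecMul_transpose, rootVec, Matrix.mulVec_mulVec,
    Matrix.nonsing_inv_mul _ X.isUnit_det_finiteCartan, Matrix.one_mulVec]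
  simp only [dotProduct, Matrix.mulVec_diagonal, ratio]

theorem form_rootVec_rootVec (X : AffineType) (b c : Fin X.rank → ℝ) :
    X.form (X.rootVec b) (X.rootVec c) = X.datum.gram (extend b) (extend c) := by
  rw [form_rootVec, gram_extend]

theorem form_comm (X : AffineType) (x y : X.Space) : X.form x y = X.form y x := by
  obtain ⟨b, rfl⟩ := X.exists_eq_rootVec x
  obtain ⟨c, rfl⟩ := X.exists_eq_rootVec y
  rw [form_rootVec_rootVec, form_rootVec_rootVec, CartanDatum.gram_comm]

theorem form_self_nonneg (X : AffineType) (x : X.Space) : 0 ≤ X.form x x := by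
  obtain ⟨b, rfl⟩ := X.exists_eq_rootVec x
  rw [form_rootVec_rootVec]
  exact X.datum.gram_self_nonneg _

theorem simpleRoot_eq_rootVec (X : AffineType) (j : Fin X.rank) :
    X.simpleRoot j = X.rootVec (Pi.single j 1) := by
  ext i
  simp [simpleRoot, rootVec, Matrix.mulVec_single]

theorem form_simpleRoot (X : AffineType) (j : Fin X.rank) (y : X.Space) :
    X.form (X.simpleRoot j) y = X.ratio j * y j := by
  rw [simpleRoot_eq_rootVec, form_rootVec, Finset.sum_eq_single j]
  · simp
  · intro i _ h; simp [h]
  · simp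

theorem rootVec_eq_sum (X : AffineType) (b : Fin X.rank → ℝ) :
    X.rootVec b = ∑ j, b j • X.simpleRoot j := by
  ext i
  simp [rootVec_apply, simpleRoot, mul_comm]

theorem theta_eq_rootVec (X : AffineType) : X.theta = X.rootVec fun i => X.label (i + 1) := by
  rw [rootVec_eq_sum, theta]

theorem theta_apply (X : AffineType) (i : Fin X.rank) :
    X.theta i = -(X.label 0 * X.cartanEntry (i + 1) 0) := by
  have h := X.datum.null i.succ
  rw [Fin.sum_univ_succ] at h
  simp [datum] at h
  simp only [theta_eq_rootVec, rootVec_apply, finiteCartan, Matrix.of_apply]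
  linarith

theorem form_theta (X : AffineType) (y : X.Space) :
    X.form X.theta y = ∑ i : Fin X.rank, (X.dualLabel (i + 1) : ℝ) * y i := by
  rw [theta_eq_rootVec, form_rootVec]
  refine Finset.sum_congr rfl fun i _ => ?_
  have := X.label_ne_zero i
  rw [ratio]
  field_simp

/-- The dual labels are the null vector of the transposed matrix. -/
theorem dual_null (X : AffineType) (j : Fin (X.rank + 1)) :
    ∑ i : Fin (X.rank + 1), (X.dualLabel i : ℝ) * X.cartanEntry i j = 0 := by
  have h := X.datum.dual.null j
  simp only [CartanDatum.dual, datum] at h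
  rw [← h]
  refine Finset.sum_congr rfl fun i _ => ?_
  have : (X.label i : ℝ) ≠ 0 := (X.datum.u_pos i).ne'
  field_simp

theorem form_theta_theta (X : AffineType) : X.form X.theta X.theta = 2 * X.label 0 := by
  have h := X.dual_null 0
  rw [Fin.sum_univ_succ] at h
  simp [cartanEntry_self, dualLabel_zero] at h
  rw [form_theta]
  simp only [theta_apply]
  have e : ∑ i : Fin X.rank, (X.dualLabel (i + 1) : ℝ) * -(X.label 0 * X.cartanEntry (i + 1) 0)
      = -(X.label 0 * ∑ i : Fin X.rank, (X.dualLabel (i + 1) : ℝ) * X.cartanEntry (i + 1) 0) := by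
    rw [Finset.mul_sum, ← Finset.sum_neg_distrib]
    refine Finset.sum_congr rfl fun i _ => by ring
  rw [e]
  linear_combination (-(X.label 0 : ℝ)) * h

/-! ### The finite Weyl group and its reflections -/

theorem simpleReflection_apply (X : AffineType) (j : Fin X.rank) (x : X.Space) :
    X.simpleReflection j x = x - x j • X.simpleRoot j := by
  rw [simpleReflection, Module.reflection_apply]; rfl

/-- The simple reflection as an element of the finite Weyl group. -/
def simpleWeyl (X : AffineType) (j : Fin X.rank) : X.weylGroup :=
  ⟨X.simpleReflection j, Subgroup.subset_closure ⟨j, rfl⟩⟩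

theorem simpleReflection_mul_self (X : AffineType) (j : Fin X.rank) :
    X.simpleReflection j * X.simpleReflection j = 1 := by
  ext1 y
  exact Module.involutive_reflection (X.simpleCoroot_simpleRoot j) y

theorem det_simpleReflection (X : AffineType) (j : Fin X.rank) :
    LinearMap.det (X.simpleReflection j : X.Space →ₗ[ℝ] X.Space) = -1 := by
  have : (X.simpleReflection j : X.Space →ₗ[ℝ] X.Space)
      = LinearMap.transvection (X.simpleCoroot j) (-X.simpleRoot j) := by
    refine LinearMap.ext fun x => ?_
    simp [LinearMap.transvection, simpleReflection, Module.reflection_apply, sub_eq_add_neg]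
  rw [this, LinearMap.transvection.det, map_neg, simpleCoroot_simpleRoot]
  norm_num

theorem exists_word (X : AffineType) (w : X.weylGroup) : ∃ l : List (Fin X.rank),
    (l.map X.simpleReflection).prod = (w : X.Space ≃ₗ[ℝ] X.Space) := by
  obtain ⟨w, hw⟩ := w
  change ∃ l : List (Fin X.rank), (l.map X.simpleReflection).prod = w
  induction hw using Subgroup.closure_induction'' with
  | mem v hv =>
    obtain ⟨j, rfl⟩ := hv
    exact ⟨[j], by simp⟩
  | inv_mem v hv =>
    obtain ⟨j, rfl⟩ := hv
    refine ⟨[j], ?_⟩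
    rw [eq_inv_iff_mul_eq_one]
    simpa using X.simpleReflection_mul_self j
  | one => exact ⟨[], rfl⟩
  | mul u v _ _ hu hv =>
    obtain ⟨l, hl⟩ := hu
    obtain ⟨l', hl'⟩ := hv
    exact ⟨l ++ l', by simp [hl, hl']⟩

theorem weyl_induction (X : AffineType) {p : X.weylGroup → Prop} (one : p 1)
    (mul : ∀ j w, p w → p (X.simpleWeyl j * w)) (w : X.weylGroup) : p w := by
  obtain ⟨l, hl⟩ := X.exists_word w
  have e : w = (l.map X.simpleWeyl).prod := by
    apply Subtype.ext
    rw [← hl, Subgroup.val_list_prod, List.map_map]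
    rfl
  rw [e]
  clear e hl
  induction l with
  | nil => simpa using one
  | cons j l ih => simpa using mul j _ ih

theorem det_word (X : AffineType) (l : List (Fin X.rank)) :
    LinearMap.det ((l.map X.simpleReflection).prod : X.Space →ₗ[ℝ] X.Space)
      = (-1) ^ l.length := by
  induction l with
  | nil => exact LinearMap.det_id
  | cons j l ih =>
    rw [List.map_cons, List.prod_cons, List.length_cons, pow_succ, ← ih]
    change LinearMap.det ((X.simpleReflection j : X.Space →ₗ[ℝ] X.Space) *
      ((l.map X.simpleReflection).prod : X.Space →ₗ[ℝ] X.Space)) = _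
    rw [map_mul, det_simpleReflection, mul_comm]

/-- The sign, defined by the length, is the determinant; this makes it multiplicative. -/
theorem sign_eq_det (X : AffineType) (w : X.weylGroup) :
    X.sign w = ((LinearMap.det ((w : X.Space ≃ₗ[ℝ] X.Space) : X.Space →ₗ[ℝ] X.Space) : ℝ) : ℂ) := by
  obtain ⟨l, hl⟩ := X.exists_word w
  have hne : {k | ∃ l : List (Fin X.rank), l.length = k ∧
    (l.map X.simpleReflection).prod = (w : X.Space ≃ₗ[ℝ] X.Space)}.Nonempty := ⟨_, l, rfl, hl⟩
  obtain ⟨l', h1, h2⟩ := Nat.sInf_mem hne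
  rw [← h2, det_word, sign, length, h1]
  simp

theorem sign_one (X : AffineType) : X.sign 1 = 1 := by
  rw [sign_eq_det]
  have : LinearMap.det (((1 : X.weylGroup) : X.Space ≃ₗ[ℝ] X.Space) : X.Space →ₗ[ℝ] X.Space) = 1 :=
    LinearMap.det_id
  rw [this]; simp

theorem sign_mul (X : AffineType) (v w : X.weylGroup) :
    X.sign (v * w) = X.sign v * X.sign w := by
  rw [sign_eq_det, sign_eq_det, sign_eq_det, ← Complex.ofReal_mul, ← map_mul]
  rfl

theorem sign_simpleWeyl (X : AffineType) (j : Fin X.rank) : X.sign (X.simpleWeyl j) = -1 := by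
  rw [sign_eq_det]
  have := X.det_simpleReflection j
  rw [simpleWeyl, this]; simp

theorem form_simpleReflection (X : AffineType) (j : Fin X.rank) (x y : X.Space) :
    X.form (X.simpleReflection j x) (X.simpleReflection j y) = X.form x y := by
  have h2 : X.simpleRoot j j = 2 := X.simpleCoroot_simpleRoot j
  simp only [simpleReflection_apply, map_sub, map_smul, LinearMap.sub_apply, LinearMap.smul_apply,
    smul_eq_mul, form_simpleRoot, X.form_comm x (X.simpleRoot j), h2]
  ring

theorem form_weyl (X : AffineType) (w : X.weylGroup) (x y : X.Space) :
    X.form ((w : X.Space ≃ₗ[ℝ] X.Space) x) ((w : X.Space ≃ₗ[ℝ] X.Space) y) = X.form x y := by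
  induction w using X.weyl_induction with
  | one => rfl
  | mul j w ih => exact (X.form_simpleReflection j _ _).trans ih

/-- Let `β` be a nonnegative combination `∑ b_i α_i` of norm `2 D` with all `(a_i^∨ / a_i) b_i` in
`D ℤ`. Then the reflection in `β` is an element of the finite Weyl group, of sign `-1`. The proof
is by descent on the height: as `(β | β) > 0`, some `s_j` lowers the height, and `s_j β` is
nonnegative again by `CartanDatum.nonneg_or_nonpos`, unless `β` is a multiple of `α_j`. -/
theorem exists_weyl_eq_reflection (X : AffineType) {D : ℝ} (hD : 0 < D) (N : ℕ) :
    ∀ b : Fin X.rank → ℤ, (∀ i, 0 ≤ b i) → ∑ i, b i ≤ N →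
      (∀ i, ∃ z : ℤ, X.ratio i * b i = D * z) →
      X.form (X.rootVec fun i => b i) (X.rootVec fun i => b i) = 2 * D →
      ∃ w : X.weylGroup, X.sign w = -1 ∧ ∀ x : X.Space, (w : X.Space ≃ₗ[ℝ] X.Space) x
        = x - (X.form (X.rootVec fun i => b i) x / D) • X.rootVec fun i => (b i : ℝ) := by
  induction N with
  | zero =>
    intro b hb hsum _ hn
    have h0 : ∀ i, b i = 0 := fun i => by
      have := Finset.sum_eq_zero_iff_of_nonneg (fun i _ => hb i) |>.1
        (le_antisymm (by simpa using hsum) (Finset.sum_nonneg fun i _ => hb i))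
      exact this i (Finset.mem_univ _)
    exfalso
    rw [form_rootVec] at hn
    simp [h0] at hn
    exact hD.ne' hn
  | succ N ih =>
    intro b hb hsum hz hn
    set β : X.Space := X.rootVec fun i => (b i : ℝ) with hβ
    obtain ⟨j, hj, hβj⟩ : ∃ j, 0 < b j ∧ 0 < β j := by
      by_contra! hcon
      have : X.form β β ≤ 0 := by
        rw [hβ, form_rootVec]
        refine Finset.sum_nonpos fun i _ => ?_
        rcases (hb i).lt_or_eq with h | h
        · exact mul_nonpos_of_nonneg_of_nonpos (by exact_mod_cast hb i)
            (mul_nonpos_of_nonneg_of_nonpos (X.ratio_pos i).le (hcon i h))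
        · simp [← h]
      linarith
    have hβint : ∀ i, β i = ((∑ l : Fin X.rank, X.cartanEntry (i + 1) (l + 1) * b l : ℤ) : ℝ) :=
      fun i => by simp [hβ, rootVec_apply, finiteCartan]
    set m : ℤ := ∑ l : Fin X.rank, X.cartanEntry (j + 1) (l + 1) * b l with hm
    have hβm : β j = m := hβint j
    have hm0 : 0 < m := by rw [hβm] at hβj; exact_mod_cast hβj
    set b' : Fin X.rank → ℤ := b - Pi.single j m with hb'
    have hβ' : X.rootVec (fun i => (b' i : ℝ)) = X.simpleReflection j β := by
      rw [simpleReflection_apply, hβm, simpleRoot_eq_rootVec]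
      ext i
      simp only [hβ, rootVec_apply, Pi.sub_apply, Pi.smul_apply, smul_eq_mul, Finset.mul_sum,
        ← Finset.sum_sub_distrib]
      refine Finset.sum_congr rfl fun l _ => ?_
      rcases eq_or_ne l j with rfl | h
      · simp [hb']; ring
      · simp [hb', h]
    have hz' : ∀ i, ∃ z : ℤ, X.ratio i * b' i = D * z := by
      choose z hz using hz
      intro i
      rcases eq_or_ne i j with rfl | h
      · refine ⟨z i - ∑ l : Fin X.rank, X.cartanEntry (l + 1) (i + 1) * z l, ?_⟩
        have : X.ratio i * m = D * ∑ l : Fin X.rank, (X.cartanEntry (l + 1) (i + 1) : ℝ) * z l := by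
          rw [hm]
          push_cast
          rw [Finset.mul_sum, Finset.mul_sum]
          refine Finset.sum_congr rfl fun l _ => ?_
          have h1 := X.ratio_mul_finiteCartan i l
          simp only [finiteCartan, Matrix.of_apply] at h1
          linear_combination (b l : ℝ) * h1 + (X.cartanEntry (l + 1) (i + 1) : ℝ) * hz l
        simp only [hb', Pi.sub_apply, Pi.single_eq_same]
        push_cast
        rw [mul_sub, mul_sub, hz, this]
      · simpa [hb', h] using ⟨z i, hz i⟩
    have hn' : X.form (X.rootVec fun i => (b' i : ℝ)) (X.rootVec fun i => (b' i : ℝ)) = 2 * D := by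
      rw [hβ', form_simpleReflection, hn]
    have hpos : (∀ i, 0 ≤ b' i) ∨ (∀ i, b' i ≤ 0) := by
      have hext : (fun i => ((Fin.cons 0 b' : Fin (X.rank + 1) → ℤ) i : ℝ))
          = extend fun i => (b' i : ℝ) := by
        ext i
        refine Fin.cases ?_ (fun i => ?_) i <;> simp [extend]
      have := X.datum.nonneg_or_nonpos hD (Fin.cons 0 b') (fun i => by
        refine Fin.cases ⟨0, by simp⟩ (fun i => ?_) i
        rw [datum_d_succ]
        simpa using hz' i) (by rw [hext, ← form_rootVec_rootVec, hn'])
      refine this.imp (fun h i => ?_) (fun h i => ?_) <;> simpa using h i.succ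
    rcases hpos with h | h
    · have hsum' : ∑ i, b' i ≤ N := by
        simp only [hb', Pi.sub_apply, Finset.sum_sub_distrib]
        rw [Finset.sum_pi_single']
        simp only [Finset.mem_univ, if_true]
        push_cast at hsum
        omega
      obtain ⟨w, hw, hwx⟩ := ih b' h hsum' hz' hn'
      refine ⟨X.simpleWeyl j * w * X.simpleWeyl j, ?_, fun x => ?_⟩
      · rw [sign_mul, sign_mul, sign_simpleWeyl, hw]; norm_num
      · change X.simpleReflection j ((w : X.Space ≃ₗ[ℝ] X.Space) (X.simpleReflection j x)) = _
        have hinv : ∀ y, X.simpleReflection j (X.simpleReflection j y) = y := fun y =>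
          LinearEquiv.congr_fun (X.simpleReflection_mul_self j) y
        rw [hwx, hβ', form_simpleReflection, map_sub, map_smul, hinv, hinv]
    · have hbj : ∀ i, i ≠ j → b i = 0 := fun i hi => by
        have h1 := h i
        have h2 := hb i
        simp only [hb', Pi.sub_apply, Pi.single_eq_of_ne hi, sub_zero] at h1
        omega
      have hβj' : β = (b j : ℝ) • X.simpleRoot j := by
        rw [hβ, rootVec_eq_sum, Finset.sum_eq_single j]
        · intro i _ hi; simp [hbj i hi]
        · simp
      refine ⟨X.simpleWeyl j, X.sign_simpleWeyl j, fun x => ?_⟩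
      change X.simpleReflection j x = _
      have h2 : X.simpleRoot j j = 2 := X.simpleCoroot_simpleRoot j
      rw [hβj'] at hn ⊢
      simp only [map_smul, LinearMap.smul_apply, smul_eq_mul, form_simpleRoot, h2] at hn ⊢
      have hD' : D = (b j : ℝ) ^ 2 * X.ratio j := by linarith
      have h3 : (b j : ℝ) ≠ 0 := by exact_mod_cast hj.ne'
      have h4 := (X.ratio_pos j).ne'
      rw [simpleReflection_apply, smul_smul, hD']
      congr 2
      field_simp

end

noncomputable section

/-! ### The lattice `M` -/

/-- The reflection in `θ` belongs to the finite Weyl group. -/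
theorem weyl_theta_reflection (X : AffineType) : ∃ w : X.weylGroup, X.sign w = -1 ∧
    ∀ x : X.Space, (w : X.Space ≃ₗ[ℝ] X.Space) x
      = x - (X.form X.theta x / X.label 0) • X.theta := by
  have hθ : (X.rootVec fun i => ((X.label (i + 1) : ℤ) : ℝ)) = X.theta := by
    rw [theta_eq_rootVec]; simp
  have := X.exists_weyl_eq_reflection X.label_zero_pos
    (∑ i : Fin X.rank, X.label (i + 1)) (fun i => X.label (i + 1)) (fun i => by positivity)
    (by push_cast; exact le_rfl) (fun i => ?_) (by rw [hθ, form_theta_theta])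
  · simpa only [hθ] using this
  · obtain ⟨z, hz⟩ := X.label_zero_dvd_dualLabel i
    refine ⟨z, ?_⟩
    have := X.label_ne_zero i
    rw [ratio, hz]
    push_cast
    field_simp

theorem weyl_mem_latticeM (X : AffineType) (w : X.weylGroup) {x : X.Space}
    (hx : x ∈ X.latticeM) : (w : X.Space ≃ₗ[ℝ] X.Space) x ∈ X.latticeM := by
  induction hx using AddSubgroup.closure_induction with
  | mem x hx =>
    obtain ⟨v, rfl⟩ := hx
    exact AddSubgroup.subset_closure ⟨w * v, rfl⟩
  | zero => rw [map_zero]; exact zero_mem _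
  | add x y _ _ hx hy => rw [map_add]; exact add_mem hx hy
  | neg x _ hx => rw [map_neg]; exact neg_mem hx

theorem theta_mem_latticeM (X : AffineType) : (X.label 0 : ℝ)⁻¹ • X.theta ∈ X.latticeM :=
  AddSubgroup.subset_closure ⟨1, rfl⟩

theorem latticeM_le_weightLattice (X : AffineType) : X.latticeM ≤ X.weightLattice := by
  rw [latticeM, AddSubgroup.closure_le]
  rintro x ⟨w, rfl⟩
  refine X.weylGroup_mem w fun i => ⟨-X.cartanEntry (i + 1) 0, ?_⟩
  have := X.label_zero_pos.ne'
  change (X.label 0 : ℝ)⁻¹ * X.theta i = _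
  rw [theta_apply]
  push_cast
  field_simp

theorem smul_simpleRoot_mem_latticeM (X : AffineType) {x : X.Space} (hx : x ∈ X.latticeM)
    (j : Fin X.rank) : x j • X.simpleRoot j ∈ X.latticeM := by
  have h := sub_mem hx (X.weyl_mem_latticeM (X.simpleWeyl j) hx)
  have e : ((X.simpleWeyl j : X.weylGroup) : X.Space ≃ₗ[ℝ] X.Space) x
      = x - x j • X.simpleRoot j := X.simpleReflection_apply j x
  rwa [e, sub_sub_cancel] at h

/-- If `r ≤ a_0`, the lattice `M` contains the vectors `(a_i / a_i^∨) α_i`, which the form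
identifies with the simple coroots. Consequently `M°` is contained in `P°`. -/
theorem corootVec_mem_latticeM (X : AffineType) (hX : X.r ≤ X.label 0) (i : Fin X.rank) :
    (X.ratio i)⁻¹ • X.simpleRoot i ∈ X.latticeM := by
  have ha := X.label_zero_pos.ne'
  have key := X.coroot_vertex_induction hX
    (fun j => ∀ i : Fin X.rank, (i : ℕ) + 1 = j → (X.ratio i)⁻¹ • X.simpleRoot i ∈ X.latticeM)
    ?_ ?_ ?_
  · exact key (i + 1) (by omega) (by omega) i rfl
  -- `M` contains `⟨θ / a_0, α_i^∨⟩ α_i`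
  · rintro _ - - h i rfl
    have h1 := X.smul_simpleRoot_mem_latticeM X.theta_mem_latticeM i
    convert h1 using 2
    have hs := X.datum.symm 0 i.succ
    simp [datum, dualLabel_zero, h] at hs
    have h2 := X.label_ne_zero i
    have h3 := X.dualLabel_ne_zero i
    rw [Pi.smul_apply, theta_apply, ratio, smul_eq_mul]
    field_simp at hs ⊢
    linarith
  · rintro _ _ h1 h2 h3 h4 hij hi j rfl
    obtain ⟨i, rfl⟩ : ∃ i : Fin X.rank, _ = (i : ℕ) + 1 :=
      ⟨⟨_ - 1, by omega⟩, (Nat.sub_add_cancel h1).symm⟩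
    have h1 := neg_mem (X.smul_simpleRoot_mem_latticeM (hi i rfl) j)
    rw [← neg_smul] at h1
    convert h1 using 2
    have hs := X.ratio_mul_finiteCartan i j
    have e1 : X.finiteCartan i j = -1 := by simp [finiteCartan, hij]
    have h2 := (X.ratio_pos i).ne'
    have h3 := (X.ratio_pos j).ne'
    rw [e1] at hs
    rw [Pi.smul_apply, smul_eq_mul, simpleRoot]
    field_simp
    linarith
  -- `θ / a_0` is the combination of the vectors `(a_j / a_j^∨) α_j` with coefficients `a_j^∨ / a_0`
  · rintro _ h1 h2 hm hrest i rfl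
    have hsum : (X.label 0 : ℝ)⁻¹ • X.theta
        = ∑ j : Fin X.rank, ((X.dualLabel (j + 1) : ℝ) / X.label 0) •
          ((X.ratio j)⁻¹ • X.simpleRoot j) := by
      rw [theta, Finset.smul_sum]
      refine Finset.sum_congr rfl fun j _ => ?_
      rw [smul_smul, smul_smul]
      congr 1
      have h2 := X.label_ne_zero j
      have h3 := X.dualLabel_ne_zero j
      rw [ratio]
      field_simp
    rw [← Finset.add_sum_erase _ _ (Finset.mem_univ i), hm, div_self ha, one_smul] at hsum
    rw [← sub_eq_iff_eq_add] at hsum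
    rw [← hsum]
    refine sub_mem X.theta_mem_latticeM (sum_mem fun j hj => ?_)
    obtain ⟨z, hz⟩ := X.label_zero_dvd_dualLabel j
    have e : (X.dualLabel (j + 1) : ℝ) / X.label 0 = z := by
      rw [hz]; push_cast; field_simp
    rw [e, Nat.cast_smul_eq_nsmul]
    refine nsmul_mem (hrest (j + 1) (by omega) (by omega) ?_ j rfl) z
    intro h
    exact (Finset.mem_erase.1 hj).1 (Fin.ext (by omega))

theorem label_zero_eq_one (X : AffineType) (hX : X.label 0 < X.r) : X.label 0 = 1 := by
  cases X <;> simp [label, r] at hX ⊢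
  split_ifs at hX ⊢ <;> omega

/-- If `r > a_0`, the lattice `M` contains the simple roots. Consequently `M°` is contained in the
lattice of coweights. -/
theorem simpleRoot_mem_latticeM (X : AffineType) (hX : X.label 0 < X.r) (i : Fin X.rank) :
    X.simpleRoot i ∈ X.latticeM := by
  have ha := X.label_zero_eq_one hX
  have hθ := X.theta_mem_latticeM
  rw [ha, Nat.cast_one, inv_one, one_smul] at hθ
  have key := X.root_vertex_induction hX
    (fun j => ∀ i : Fin X.rank, (i : ℕ) + 1 = j → X.simpleRoot i ∈ X.latticeM) ?_ ?_ ?_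
  · exact key (i + 1) (by omega) (by omega) i rfl
  · rintro _ - - h i rfl
    have h1 := X.smul_simpleRoot_mem_latticeM hθ i
    rw [theta_apply, ha, h] at h1
    simpa using h1
  · rintro _ _ h1 h2 h3 h4 hij hi j rfl
    obtain ⟨i, rfl⟩ : ∃ i : Fin X.rank, _ = (i : ℕ) + 1 :=
      ⟨⟨_ - 1, by omega⟩, (Nat.sub_add_cancel h1).symm⟩
    have h1 := neg_mem (X.smul_simpleRoot_mem_latticeM (hi i rfl) j)
    have e1 : X.simpleRoot i j = -1 := by simp [simpleRoot, finiteCartan, hij]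
    rw [e1] at h1
    simpa using h1
  · rintro _ h1 h2 hm hrest i rfl
    have hsum : X.theta = ∑ j : Fin X.rank, (X.label (j + 1) : ℝ) • X.simpleRoot j := rfl
    rw [← Finset.add_sum_erase _ _ (Finset.mem_univ i), hm, Nat.cast_one, one_smul,
      ← sub_eq_iff_eq_add] at hsum
    rw [← hsum]
    refine sub_mem hθ (sum_mem fun j hj => ?_)
    rw [Nat.cast_smul_eq_nsmul]
    refine nsmul_mem (hrest (j + 1) (by omega) (by omega) ?_ j rfl) _
    intro h
    exact (Finset.mem_erase.1 hj).1 (Fin.ext (by omega))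

/-! ### The affine Weyl group and the open alcove -/

/-- The point `x` as a weight of level `k`, given by its values on the simple coroots
`α_0^∨, …, α_n^∨`; as `a_0^∨ = 1`, the value on `α_0^∨` is `k - ∑ i ≥ 1, a_i^∨ ⟨x, α_i^∨⟩`. -/
def levelCoord (X : AffineType) (k : ℝ) (x : X.Space) : Fin (X.rank + 1) → ℝ :=
  Fin.cons (k - X.form X.theta x) x

@[simp] theorem levelCoord_zero (X : AffineType) (k : ℝ) (x : X.Space) :
    X.levelCoord k x 0 = k - X.form X.theta x := rfl

@[simp] theorem levelCoord_succ (X : AffineType) (k : ℝ) (x : X.Space) (i : Fin X.rank) :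
    X.levelCoord k x i.succ = x i := rfl

theorem levelCoord_injective (X : AffineType) (k : ℝ) : Function.Injective (X.levelCoord k) :=
  fun x y h => funext fun i => congrFun h i.succ

theorem form_theta_simpleRoot (X : AffineType) (j : Fin X.rank) :
    X.form X.theta (X.simpleRoot j) = -X.cartanEntry 0 (j + 1) := by
  have h := X.dual_null j.succ
  rw [Fin.sum_univ_succ] at h
  simp [dualLabel_zero] at h
  rw [form_theta]
  simp only [simpleRoot, finiteCartan, Matrix.of_apply]
  linarith

theorem levelCoord_simpleReflection (X : AffineType) (k : ℝ) (j : Fin X.rank) (x : X.Space) :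
    X.levelCoord k (X.simpleReflection j x)
      = X.datum.dual.weightReflection j.succ (X.levelCoord k x) := by
  ext i
  rw [CartanDatum.weightReflection_apply, simpleReflection_apply]
  refine Fin.cases ?_ (fun i => ?_) i
  · simp [form_theta_simpleRoot, CartanDatum.dual, datum]
    ring
  · simp [CartanDatum.dual, datum, simpleRoot, finiteCartan]

/-- The reflection in the wall `(θ | x) = k` is the simple reflection of the vertex `0`. -/
theorem levelCoord_affineReflection (X : AffineType) (k : ℝ) (x : X.Space) :
    X.levelCoord k (x - (X.form X.theta x / X.label 0) • X.theta
        + k • ((X.label 0 : ℝ)⁻¹ • X.theta))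
      = X.datum.dual.weightReflection 0 (X.levelCoord k x) := by
  have ha := X.label_zero_pos.ne'
  ext i
  rw [CartanDatum.weightReflection_apply]
  refine Fin.cases ?_ (fun i => ?_) i
  · simp [form_theta_theta, CartanDatum.dual, datum, cartanEntry_self]
    field_simp
    ring
  · simp [CartanDatum.dual, datum, theta_apply]
    field_simp
    ring

/-- The map `f` is, in the coordinates at level `k`, a product of simple reflections of the affine
Weyl group, whose roots are here the coroots of `X`. -/
def IsAffineWord (X : AffineType) (k : ℝ) (f : X.Space → X.Space) : Prop :=
  ∃ L, ∀ x, X.levelCoord k (f x) = X.datum.dual.weightWord L (X.levelCoord k x)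

variable {X : AffineType} {k : ℝ}

theorem IsAffineWord.comp {f g : X.Space → X.Space} (hf : X.IsAffineWord k f)
    (hg : X.IsAffineWord k g) :
    X.IsAffineWord k (fun x => f (g x)) := by
  obtain ⟨L, hL⟩ := hf
  obtain ⟨L', hL'⟩ := hg
  refine ⟨L ++ L', fun x => ?_⟩
  rw [hL, hL', CartanDatum.weightWord_append]; rfl

theorem IsAffineWord.inverse {f g : X.Space → X.Space} (hf : X.IsAffineWord k f)
    (h : ∀ x, f (g x) = x) :
    X.IsAffineWord k g := by
  obtain ⟨L, hL⟩ := hf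
  refine ⟨L.reverse, fun x => ?_⟩
  have h1 := hL (g x)
  rw [h] at h1
  rw [h1, ← Module.End.mul_apply, CartanDatum.weightWord_reverse_mul]; rfl

theorem isAffineWord_simpleReflection (j : Fin X.rank) : X.IsAffineWord k (X.simpleReflection j) :=
  ⟨[j.succ], fun x => by rw [levelCoord_simpleReflection]; simp⟩

theorem isAffineWord_weyl (w : X.weylGroup) : X.IsAffineWord k (w : X.Space ≃ₗ[ℝ] X.Space) := by
  induction w using X.weyl_induction with
  | one => exact ⟨[], fun x => rfl⟩
  | mul j w ih => exact (isAffineWord_simpleReflection j).comp ih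

/-- The translations by `k M` belong to the affine Weyl group. For the generator `θ / a_0` the
translation is the product of the reflections in the walls `(θ | x) = k` and `(θ | x) = 0`; the
other generators are its conjugates. -/
theorem isAffineWord_translation {m : X.Space} (hm : m ∈ X.latticeM) :
    X.IsAffineWord k (fun x => x + k • m) := by
  induction hm using AddSubgroup.closure_induction with
  | mem m hm =>
    obtain ⟨w, rfl⟩ := hm
    have h0 : X.IsAffineWord k (fun x => x + k • ((X.label 0 : ℝ)⁻¹ • X.theta)) := by
      obtain ⟨v, -, hv⟩ := X.weyl_theta_reflection
      have h1 : X.IsAffineWord k (fun x => (v : X.Space ≃ₗ[ℝ] X.Space) x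
          + k • ((X.label 0 : ℝ)⁻¹ • X.theta)) :=
        ⟨[0], fun x => by simp only [hv, levelCoord_affineReflection]; simp⟩
      have h2 := h1.comp (isAffineWord_weyl (k := k) v⁻¹)
      convert h2 using 2 with x
      congr 1
      exact (LinearEquiv.apply_symm_apply (v : X.Space ≃ₗ[ℝ] X.Space) x).symm
    have h1 := ((isAffineWord_weyl (k := k) w).comp h0).comp (isAffineWord_weyl (k := k) w⁻¹)
    convert h1 using 2 with x
    simp only [map_add, map_smul]
    congr 1
    exact (LinearEquiv.apply_symm_apply (w : X.Space ≃ₗ[ℝ] X.Space) x).symm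
  | zero => exact ⟨[], fun x => by simp⟩
  | add m m' _ _ hm hm' =>
    convert hm'.comp hm using 2 with x
    rw [smul_add, add_assoc]
  | neg m _ hm => exact hm.inverse fun x => by simp

/-- Two points of the open alcove `x_i > 0`, `(θ | x) < k` that are conjugate under the group
generated by the finite Weyl group and the translations by `k M` are equal, and the conjugating
element of the finite Weyl group is the identity. -/
theorem eq_one_and_eq_of_mem_alcove {x y : X.Space} (hx : ∀ i, 0 < x i) (hx0 : X.form X.theta x < k)
    (hy : ∀ i, 0 < y i) (hy0 : X.form X.theta y < k) (w : X.weylGroup) {m : X.Space}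
    (hm : m ∈ X.latticeM) (h : y = (w : X.Space ≃ₗ[ℝ] X.Space) x + k • m) : w = 1 ∧ x = y := by
  obtain ⟨L, hL⟩ := (isAffineWord_translation (k := k) hm).comp (isAffineWord_weyl w)
  have hpos : ∀ z : X.Space, (∀ i, 0 < z i) → X.form X.theta z < k →
      ∀ j, 0 < X.levelCoord k z j := fun z hz hz0 j => by
    refine Fin.cases (by simpa using hz0) (fun j => hz j) j
  have h1 := CartanDatum.weightWord_eq_one (hpos x hx hx0) L
    (by rw [← hL]; change ∀ j, 0 < X.levelCoord k (_ + _) j; rw [← h]; exact hpos y hy hy0)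
  have h2 : ∀ z, (w : X.Space ≃ₗ[ℝ] X.Space) z + k • m = z := fun z => by
    apply X.levelCoord_injective k
    refine (hL z).trans ?_
    rw [h1]; rfl
  have h3 : k • m = 0 := by simpa using h2 0
  refine ⟨Subtype.ext (LinearEquiv.ext fun z => ?_), by rw [h, h2]⟩
  simpa [h3] using h2 z

end

noncomputable section

/-! ### Finiteness of the Weyl group, and the closed alcove -/

theorem ratio_mul_sq_le (X : AffineType) (x : X.Space) (i : Fin X.rank) :
    X.ratio i * x i ^ 2 ≤ 2 * X.form x x := by
  have h := LinearMap.BilinForm.apply_mul_apply_le_of_forall_zero_le X.form X.form_self_nonneg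
    (X.simpleRoot i) x
  have h2 : X.simpleRoot i i = 2 := X.simpleCoroot_simpleRoot i
  rw [X.form_comm x, form_simpleRoot, form_simpleRoot, h2] at h
  refine le_of_mul_le_mul_left ?_ (X.ratio_pos i)
  linarith

/-- A ball of the form meets a translate of the lattice `∏ s_i ℤ` in a finite set. -/
theorem finite_bounded_coset (X : AffineType) (c s : Fin X.rank → ℝ) (hs : ∀ i, 0 < s i) (R : ℝ) :
    {u : X.Space | (∀ i, ∃ m : ℤ, u i = c i + s i * m) ∧ X.form u u ≤ R}.Finite := by
  have key : ∀ i, {t : ℝ | (∃ m : ℤ, t = c i + s i * m) ∧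
      X.ratio i * t ^ 2 ≤ 2 * R}.Finite := fun i => by
    set B := 2 * R / X.ratio i + 1 with hB
    refine ((Set.finite_Icc ⌊(-B - c i) / s i⌋ ⌈(B - c i) / s i⌉).image
      (fun m : ℤ => c i + s i * m)).subset ?_
    rintro t ⟨⟨m, rfl⟩, ht⟩
    refine ⟨m, ?_, rfl⟩
    have h1 : (c i + s i * m) ^ 2 ≤ B - 1 := by
      rw [hB, add_sub_cancel_right, le_div_iff₀ (X.ratio_pos i)]
      linarith
    have h2 : c i + s i * m ≤ B := by nlinarith
    have h3 : -B ≤ c i + s i * m := by nlinarith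
    constructor
    · have : (-B - c i) / s i ≤ m := by rw [div_le_iff₀ (hs i)]; linarith
      exact_mod_cast (Int.floor_le _).trans this
    · have : (m : ℝ) ≤ (B - c i) / s i := by rw [le_div_iff₀ (hs i)]; linarith
      exact_mod_cast this.trans (Int.le_ceil _)
  refine (Set.Finite.pi' key).subset ?_
  rintro u ⟨h1, h2⟩ i
  exact ⟨h1 i, (X.ratio_mul_sq_le u i).trans (by linarith)⟩

theorem single_mem_weightLattice (X : AffineType) (i : Fin X.rank) :
    (Pi.single i 1 : X.Space) ∈ X.weightLattice := fun j => by
  rcases eq_or_ne j i with rfl | h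
  · exact ⟨1, by simp [simpleCoroot]⟩
  · exact ⟨0, by simp [simpleCoroot, h]⟩

theorem simpleRoot_mem_weightLattice (X : AffineType) (i : Fin X.rank) :
    X.simpleRoot i ∈ X.weightLattice := fun j =>
  ⟨X.cartanEntry (j + 1) (i + 1), by simp [simpleCoroot, simpleRoot, finiteCartan]⟩

instance (X : AffineType) : Finite X.weylGroup := by
  have hfin : ∀ i : Fin X.rank, {u : X.Space | (∀ j, ∃ m : ℤ, u j = 0 + 1 * m) ∧
      X.form u u ≤ X.form (Pi.single i 1) (Pi.single i 1)}.Finite := fun i =>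
    X.finite_bounded_coset (fun _ => 0) (fun _ => 1) (fun _ => one_pos) _
  refine Set.finite_univ_iff.1 (Set.Finite.of_injOn (s := (Set.univ : Set X.weylGroup))
    (f := fun (w : X.weylGroup) i => (w : X.Space ≃ₗ[ℝ] X.Space) (Pi.single i 1)) ?_ ?_
    (Set.Finite.pi' hfin))
  · intro w _ i
    refine ⟨fun j => ?_, (X.form_weyl w _ _).le⟩
    obtain ⟨m, hm⟩ := X.weylGroup_mem w (X.single_mem_weightLattice i) j
    exact ⟨m, by rw [zero_add, one_mul]; exact hm⟩
  · intro v _ w _ h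
    apply Subtype.ext
    apply LinearEquiv.toLinearMap_injective
    refine LinearMap.pi_ext' fun i => LinearMap.ext_ring ?_
    exact congrFun h i

/-- The lattice of all `q` with `⟨q, x⟩ ∈ ℤ` for all `x ∈ P°`. -/
def dualP (X : AffineType) : AddSubgroup X.Space where
  carrier := {q | ∀ x ∈ X.weightLattice, ∃ m : ℤ, X.form q x = m}
  zero_mem' x _ := ⟨0, by simp⟩
  add_mem' hu hv x hx := by
    obtain ⟨a, ha⟩ := hu x hx
    obtain ⟨b, hb⟩ := hv x hx
    exact ⟨a + b, by simp [ha, hb]⟩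
  neg_mem' hu x hx := by
    obtain ⟨a, ha⟩ := hu x hx
    exact ⟨-a, by simp [ha]⟩

theorem form_weyl_left (X : AffineType) (w : X.weylGroup) (x y : X.Space) :
    X.form ((w : X.Space ≃ₗ[ℝ] X.Space) x) y
      = X.form x (((w⁻¹ : X.weylGroup) : X.Space ≃ₗ[ℝ] X.Space) y) := by
  rw [← X.form_weyl w⁻¹]
  congr 2
  exact LinearEquiv.symm_apply_apply (w : X.Space ≃ₗ[ℝ] X.Space) x

theorem weyl_mem_dualP (X : AffineType) (w : X.weylGroup) {q : X.Space} (hq : q ∈ X.dualP) :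
    (w : X.Space ≃ₗ[ℝ] X.Space) q ∈ X.dualP := fun x hx => by
  rw [form_weyl_left]
  exact hq _ (X.weylGroup_mem w⁻¹ hx)

theorem weyl_mem_dualM (X : AffineType) (w : X.weylGroup) {q : X.Space} (hq : q ∈ X.dualM) :
    (w : X.Space ≃ₗ[ℝ] X.Space) q ∈ X.dualM := fun x hx => by
  rw [form_weyl_left]
  exact hq _ (X.weyl_mem_latticeM w⁻¹ hx)

theorem dualP_le_dualM (X : AffineType) : X.dualP ≤ X.dualM :=
  fun _ hq x hx => hq x (X.latticeM_le_weightLattice hx)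

/-- Let `η = ∑ c_i α_i` be a vector of norm `2 D` whose reflection `w₀` belongs to the finite Weyl
group, and let `D⁻¹ η` be integral on `P°`. Then every point can be moved into the closed alcove
`u_i ≥ 0`, `(η | u) ≤ k` by the finite Weyl group and translations by multiples `k q` of vectors
integral on `P°`. A point of the orbit at minimal distance from an interior point of the alcove
works: reflecting it in a wall that separates it from the interior point would bring it closer. -/
theorem exists_mem_closed_alcove (X : AffineType) {k D : ℝ} (hk : 1 ≤ k) (hD : 0 < D)
    (c : Fin X.rank → ℕ)
    (hη : X.form (X.rootVec fun i => c i) (X.rootVec fun i => c i) = 2 * D)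
    (w₀ : X.weylGroup) (hw₀ : ∀ x : X.Space, (w₀ : X.Space ≃ₗ[ℝ] X.Space) x
      = x - (X.form (X.rootVec fun i => c i) x / D) • X.rootVec fun i => (c i : ℝ))
    (hηP : D⁻¹ • (X.rootVec fun i => (c i : ℝ)) ∈ X.dualP) (v : X.Space) :
    ∃ w : X.weylGroup, ∃ q ∈ X.dualP,
      (∀ i, 0 ≤ ((w : X.Space ≃ₗ[ℝ] X.Space) v + k • q) i) ∧
      X.form (X.rootVec fun i => c i) ((w : X.Space ≃ₗ[ℝ] X.Space) v + k • q) ≤ k := by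
  set η : X.Space := X.rootVec fun i => (c i : ℝ) with hηdef
  set H : ℝ := 1 + ∑ i, (c i : ℝ) with hH
  have hH0 : 0 < H := by positivity
  -- An interior point of the alcove: every `(α_i | p)` is `1 / H`, so that `(η | p) < 1 ≤ k`.
  set p : X.Space := fun i => (H * X.ratio i)⁻¹ with hp
  have hpα : ∀ i, 0 < X.ratio i * p i := fun i =>
    mul_pos (X.ratio_pos i) (inv_pos.2 (mul_pos hH0 (X.ratio_pos i)))
  have hpη : X.form η p < k := by
    refine lt_of_lt_of_le ?_ hk
    have : X.form η p = (∑ i, (c i : ℝ)) / H := by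
      rw [hηdef, form_rootVec, Finset.sum_div]
      refine Finset.sum_congr rfl fun i _ => ?_
      have := (X.ratio_pos i).ne'
      rw [hp]
      field_simp
    rw [this, div_lt_one hH0, hH]
    linarith
  set T : Set X.Space := {u | ∃ w : X.weylGroup, ∃ q ∈ X.dualP,
    u = (w : X.Space ≃ₗ[ℝ] X.Space) v + k • q} with hT
  have hvT : v ∈ T := ⟨1, 0, zero_mem _, by simp⟩
  set R := X.form (v - p) (v - p)
  have hfin : {u ∈ T | X.form (u - p) (u - p) ≤ R}.Finite := by
    refine (Set.finite_iUnion fun w : X.weylGroup => ((X.finite_bounded_coset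
      ((w : X.Space ≃ₗ[ℝ] X.Space) v - p) (fun i => k / X.ratio i)
      (fun i => div_pos (by linarith) (X.ratio_pos i)) R).image (fun u => u + p))).subset ?_
    rintro u ⟨⟨w, q, hq, rfl⟩, hu⟩
    refine Set.mem_iUnion.2 ⟨w, _, ⟨fun i => ?_, hu⟩, sub_add_cancel _ _⟩
    obtain ⟨m, hm⟩ := hq _ (X.simpleRoot_mem_weightLattice i)
    refine ⟨m, ?_⟩
    rw [form_comm, form_simpleRoot] at hm
    have := (X.ratio_pos i).ne'
    simp only [Pi.sub_apply, Pi.add_apply, Pi.smul_apply, smul_eq_mul, ← hm]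
    field_simp
    ring
  obtain ⟨u, ⟨huT, huR⟩, hmin⟩ := Set.exists_min_image _ (fun u => X.form (u - p) (u - p)) hfin
    ⟨v, hvT, le_rfl⟩
  have hmin' : ∀ u' ∈ T, X.form (u - p) (u - p) ≤ X.form (u' - p) (u' - p) := fun u' hu' => by
    by_cases h : X.form (u' - p) (u' - p) ≤ R
    · exact hmin u' ⟨hu', h⟩
    · linarith
  have hexp : ∀ (y : X.Space) (t : ℝ), X.form (u + t • y - p) (u + t • y - p)
      = X.form (u - p) (u - p) + 2 * t * (X.form y u - X.form y p) + t ^ 2 * X.form y y :=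
    fun y t => by
    simp only [map_sub, map_add, map_smul, LinearMap.sub_apply, LinearMap.add_apply,
      LinearMap.smul_apply, smul_eq_mul, X.form_comm u y, X.form_comm p y]
    ring
  obtain ⟨w, q, hq, rfl⟩ := huT
  refine ⟨w, q, hq, fun i => ?_, ?_⟩
  · by_contra! hneg
    set u := (w : X.Space ≃ₗ[ℝ] X.Space) v + k • q with hu
    have h1 := hmin' (X.simpleReflection i u)
      ⟨X.simpleWeyl i * w, _, X.weyl_mem_dualP (X.simpleWeyl i) hq, by
        rw [hu, map_add, map_smul]; rfl⟩
    have h2 : X.simpleReflection i u = u + (-u i) • X.simpleRoot i := by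
      rw [simpleReflection_apply, neg_smul, sub_eq_add_neg]
    have h3 : X.simpleRoot i i = 2 := X.simpleCoroot_simpleRoot i
    rw [h2, hexp, form_simpleRoot, form_simpleRoot, form_simpleRoot, h3] at h1
    nlinarith [hpα i]
  · by_contra! hgt
    set u := (w : X.Space ≃ₗ[ℝ] X.Space) v + k • q with hu
    have h1 := hmin' ((w₀ : X.Space ≃ₗ[ℝ] X.Space) u + k • (D⁻¹ • η))
      ⟨w₀ * w, _, add_mem (X.weyl_mem_dualP w₀ hq) hηP, by
        rw [hu, map_add, map_smul, smul_add, add_assoc]; rfl⟩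
    have h2 : (w₀ : X.Space ≃ₗ[ℝ] X.Space) u + k • (D⁻¹ • η)
        = u + ((k - X.form η u) / D) • η := by
      rw [hw₀, smul_smul, sub_add, ← sub_smul, sub_eq_add_neg, ← neg_smul]
      congr 2
      field_simp
      ring
    rw [h2, hexp, hη] at h1
    set t := (k - X.form η u) / D with ht
    have ht0 : t < 0 := div_neg_of_neg_of_pos (by linarith) hD
    have h3 : X.form η u = k - t * D := by rw [ht]; field_simp; ring
    rw [h3] at h1
    nlinarith [mul_pos_of_neg_of_neg ht0 (by linarith : X.form η p - k < 0)]

end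

noncomputable section

/-! ### The finite group `G_ℓ` and its characters -/

/-- The weight with the given integral coordinates in the basis of fundamental weights. -/
def intWeight (X : AffineType) : (Fin X.rank → ℤ) →+ X.weightLattice where
  toFun m := ⟨fun i => (m i : ℝ), fun i => ⟨m i, rfl⟩⟩
  map_zero' := Subtype.ext (funext fun _ => Int.cast_zero)
  map_add' _ _ := Subtype.ext (funext fun _ => Int.cast_add _ _)

theorem intWeight_surjective (X : AffineType) : Function.Surjective X.intWeight := by
  rintro ⟨x, hx⟩
  have hx' := hx
  choose m hm using hx'
  exact ⟨m, Subtype.ext (funext fun i => (hm i).symm)⟩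

theorem dualCoxeter_eq (X : AffineType) :
    X.dualCoxeter = 1 + ∑ i : Fin X.rank, X.dualLabel (i + 1) := by
  rw [dualCoxeter, Fin.sum_univ_succ]
  simp [dualLabel_zero]

theorem level_pos (X : AffineType) (ℓ : ℕ) : 0 < ℓ + X.dualCoxeter := by
  rw [dualCoxeter_eq]; omega

theorem mem_scaledM (X : AffineType) (ℓ : ℕ) (x : X.weightLattice) : x ∈ X.scaledM ℓ ↔
    ∃ m ∈ X.latticeM, (x : X.Space) = ((ℓ + X.dualCoxeter : ℕ) : ℝ) • m := by
  rw [scaledM, AddSubgroup.mem_addSubgroupOf, AddSubgroup.mem_map]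
  refine exists_congr fun m => and_congr_right fun _ => ?_
  rw [nsmulAddMonoidHom_apply, Nat.cast_smul_eq_nsmul, eq_comm]

theorem isOfFinAddOrder_mk (X : AffineType) (ℓ : ℕ) {n : ℕ} (hn : n ≠ 0) {x : X.weightLattice}
    (h : n • (x : X.Space) ∈ X.latticeM) : IsOfFinAddOrder (QuotientAddGroup.mk x : X.G ℓ) := by
  rw [isOfFinAddOrder_iff_nsmul_eq_zero]
  refine ⟨(ℓ + X.dualCoxeter) * n, Nat.mul_pos (X.level_pos ℓ) (Nat.pos_of_ne_zero hn), ?_⟩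
  rw [← QuotientAddGroup.mk_nsmul, QuotientAddGroup.eq_zero_iff, mem_scaledM]
  refine ⟨_, h, ?_⟩
  rw [Nat.cast_smul_eq_nsmul, ← mul_smul]
  rfl

theorem label_smul_simpleRoot_mem_latticeM (X : AffineType) (j : Fin X.rank) :
    X.label (j + 1) • X.simpleRoot j ∈ X.latticeM := by
  rcases le_or_gt X.r (X.label 0) with h | h
  · have := nsmul_mem (X.corootVec_mem_latticeM h j) (X.dualLabel (j + 1))
    convert this using 1
    rw [← Nat.cast_smul_eq_nsmul ℝ, ← Nat.cast_smul_eq_nsmul ℝ, smul_smul, ratio]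
    congr 1
    have h2 := X.label_ne_zero j
    have h3 := X.dualLabel_ne_zero j
    field_simp
  · exact nsmul_mem (X.simpleRoot_mem_latticeM h j) _

/-- A quotient of `ℤⁿ` is finite if the columns of a nonsingular matrix have finite order in it,
since `det A • m = A (adj A) m` is a combination of the columns. -/
theorem finite_of_isOfFinAddOrder_col {n : ℕ} {G : Type*} [AddCommGroup G]
    {φ : (Fin n → ℤ) →+ G} (hφ : Function.Surjective φ) {A : Matrix (Fin n) (Fin n) ℤ}
    (hdet : A.det ≠ 0) (h : ∀ j, IsOfFinAddOrder (φ (A.col j))) : Finite G := by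
  have hfg : AddGroup.FG G := AddGroup.fg_of_surjective hφ
  refine AddCommGroup.finite_of_fg_isAddTorsion _ fun g => ?_
  obtain ⟨m, rfl⟩ := hφ g
  set T := (AddCommGroup.torsion G).comap φ with hT
  have hm : A.det • m ∈ T := by
    have : A.det • m = A.mulVec (A.adjugate.mulVec m) := by
      rw [Matrix.mulVec_mulVec, Matrix.mul_adjugate, Matrix.smul_mulVec, Matrix.one_mulVec]
    rw [this, Matrix.mulVec_eq_sum]
    refine sum_mem fun j _ => ?_
    have hj : A.col j ∈ T := h j
    rw [op_smul_eq_smul]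
    exact zsmul_mem hj _
  have hm' : A.det.natAbs • m ∈ T := by
    rcases Int.natAbs_eq A.det with h | h <;> rw [h] at hm
    · simpa only [natCast_zsmul] using hm
    · simpa only [neg_smul, natCast_zsmul, neg_mem_iff] using hm
  have hm'' : IsOfFinAddOrder (φ (A.det.natAbs • m)) := hm'
  rw [map_nsmul] at hm''
  exact hm''.of_nsmul (Int.natAbs_ne_zero.2 hdet)

instance (X : AffineType) (ℓ : ℕ) : Finite (X.G ℓ) := by
  refine finite_of_isOfFinAddOrder_col
    (φ := (QuotientAddGroup.mk' (X.scaledM ℓ)).comp X.intWeight)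
    ((QuotientAddGroup.mk'_surjective _).comp X.intWeight_surjective)
    (A := Matrix.of fun i j => X.cartanEntry (i + 1) (j + 1)) ?_ fun j =>
      X.isOfFinAddOrder_mk ℓ (X.label_pos (j + 1) (by omega)).ne'
      (X.label_smul_simpleRoot_mem_latticeM j)
  intro h
  have h1 := X.isUnit_det_finiteCartan.ne_zero
  have h2 : X.finiteCartan
      = (Matrix.of fun i j : Fin X.rank => X.cartanEntry (i + 1) (j + 1)).map
        (Int.castRingHom ℝ) := by
    ext i j; simp [finiteCartan]
  rw [h2, ← RingHom.mapMatrix_apply, ← RingHom.map_det, h] at h1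
  exact h1 (map_zero _)

theorem iota_mk (X : AffineType) (ℓ : ℕ) (v : X.dualM) (x : X.weightLattice) :
    X.iota ℓ v (QuotientAddGroup.mk x)
      = Circle.exp (2 * Real.pi / (ℓ + X.dualCoxeter : ℕ) * X.form v x) := rfl

/-- Every character of `G_ℓ` is of the form `ι_1(v)` with `v ∈ M°`. The vector `v` is read off from
the arguments of the values at the fundamental weights, and triviality on `(ℓ + h^∨) M` places it
in `M°`. -/
theorem iota_surjective (X : AffineType) (ℓ : ℕ) : Function.Surjective (X.iota ℓ) := by
  intro χ
  have hk : ((ℓ + X.dualCoxeter : ℕ) : ℝ) ≠ 0 := by exact_mod_cast (X.level_pos ℓ).ne'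
  set k : ℝ := ((ℓ + X.dualCoxeter : ℕ) : ℝ) with hkdef
  set ψ : X.weightLattice →+ Additive Circle :=
    (AddChar.toAddMonoidHomEquiv χ).comp (QuotientAddGroup.mk' (X.scaledM ℓ)) with hψ
  have hπ := Real.pi_pos.ne'
  set v : X.Space := X.rootVec fun i =>
    (Circle.argEquiv (ψ (X.intWeight (Pi.single i 1))).toMul : ℝ) * k /
      (2 * Real.pi * X.ratio i) with hv
  have hagree : X.latticeChar ℓ v = ψ := by
    have : (X.latticeChar ℓ v).comp X.intWeight = ψ.comp X.intWeight := by
      refine AddMonoidHom.functions_ext' _ _ _ fun i => AddMonoidHom.ext_int ?_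
      change Additive.ofMul (Circle.exp (2 * Real.pi / k *
        X.form v (X.intWeight (Pi.single i 1) : X.weightLattice))) = ψ (X.intWeight (Pi.single i 1))
      have e : 2 * Real.pi / k * X.form v (X.intWeight (Pi.single i 1) : X.weightLattice)
          = Circle.argEquiv (ψ (X.intWeight (Pi.single i 1))).toMul := by
        rw [hv, form_rootVec, Finset.sum_eq_single i]
        · have := (X.ratio_pos i).ne'
          simp [intWeight]
          field_simp
        · intro j _ hj; simp [intWeight, hj]
        · simp
      rw [e]
      exact congrArg Additive.ofMul (Circle.exp_arg _)
    ext x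
    obtain ⟨m, rfl⟩ := X.intWeight_surjective x
    exact congrArg _ (DFunLike.congr_fun this m)
  have hvM : v ∈ X.dualM := by
    intro x hx
    have hxP := X.latticeM_le_weightLattice hx
    set y : X.weightLattice := (ℓ + X.dualCoxeter) • ⟨x, hxP⟩ with hy
    have hyk : (y : X.Space) = k • x := by
      rw [hkdef, Nat.cast_smul_eq_nsmul]; rfl
    have h0 : ψ y = 0 := by
      have : (QuotientAddGroup.mk y : X.G ℓ) = 0 :=
        (QuotientAddGroup.eq_zero_iff y).2 ((X.mem_scaledM ℓ y).2 ⟨x, hx, hyk⟩)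
      change AddChar.toAddMonoidHomEquiv χ (QuotientAddGroup.mk y) = 0
      rw [this, map_zero]
    rw [← hagree] at h0
    have h1 : Circle.exp (2 * Real.pi / k * X.form v y) = 1 := h0
    obtain ⟨m, hm⟩ := Circle.exp_eq_one.1 h1
    refine ⟨m, ?_⟩
    rw [hyk, map_smul, smul_eq_mul] at hm
    field_simp at hm
    exact hm
  refine ⟨⟨v, hvM⟩, ?_⟩
  ext g
  obtain ⟨x, rfl⟩ := QuotientAddGroup.mk_surjective g
  exact congrArg (fun z : Circle => (z : ℂ)) (congrArg Additive.toMul (DFunLike.congr_fun hagree x))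

/-! ### The Fourier transform of the alternants -/

section Fourier

variable {G : Type*} [AddCommGroup G]

theorem fourier_eq_sum [Fintype G] (f : AddMonoidAlgebra ℂ G) (χ : AddChar G Circle) :
    fourier f χ = (((Nat.card G : ℝ) ^ (-(1 / 2) : ℝ) : ℝ) : ℂ) *
      ∑ σ, f.coeff σ * starRingEnd ℂ (χ σ : ℂ) := by
  rw [fourier, Finsupp.sum_fintype _ _ (fun _ => zero_mul _)]

theorem fourier_sum_smul [Finite G] {ι : Type*} (s : Finset ι) (g : ι → ℂ)
    (f : ι → AddMonoidAlgebra ℂ G) (χ : AddChar G Circle) :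
    fourier (∑ i ∈ s, g i • f i) χ = ∑ i ∈ s, g i * fourier (f i) χ := by
  have := Fintype.ofFinite G
  simp only [fourier_eq_sum, AddMonoidAlgebra.coeff_sum, AddMonoidAlgebra.coeff_smul,
    Finsupp.coe_finsetSum, Finset.sum_apply, Finsupp.smul_apply, smul_eq_mul, Finset.sum_mul,
    Finset.mul_sum]
  rw [Finset.sum_comm]
  refine Finset.sum_congr rfl fun i _ => Finset.sum_congr rfl fun σ _ => by ring

/-- Injectivity of the Fourier transform, by orthogonality of characters. -/
theorem eq_zero_of_fourier_eq_zero [Finite G] {f : AddMonoidAlgebra ℂ G}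
    (h : ∀ χ : AddChar G Circle, fourier f χ = 0) : f = 0 := by
  classical
  have := Fintype.ofFinite G
  have hc : (((Nat.card G : ℝ) ^ (-(1 / 2) : ℝ) : ℝ) : ℂ) ≠ 0 := by
    have : (0 : ℝ) < Nat.card G := by exact_mod_cast Nat.card_pos
    exact_mod_cast (Real.rpow_pos_of_pos this _).ne'
  have h1 : ∀ ψ : AddChar G ℂ, ∑ σ, f.coeff σ * ψ (-σ) = 0 := fun ψ => by
    have h2 := h (AddChar.circleEquivComplex.symm ψ)
    rw [fourier_eq_sum] at h2
    rw [← (mul_eq_zero.1 h2).resolve_left hc]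
    refine Finset.sum_congr rfl fun σ _ => ?_
    have h3 : ∀ τ, ψ τ = ((AddChar.circleEquivComplex.symm ψ τ : Circle) : ℂ) := fun τ => by
      conv_lhs => rw [← AddChar.circleEquivComplex.apply_symm_apply ψ]
      rfl
    rw [h3, AddChar.map_neg_eq_inv, Circle.coe_inv_eq_conj]
  apply AddMonoidAlgebra.coeff_injective
  ext τ
  have h4 : ∑ ψ : AddChar G ℂ, (∑ σ, f.coeff σ * ψ (-σ)) * ψ τ = 0 := by simp [h1]
  simp only [Finset.sum_mul] at h4
  rw [Finset.sum_comm] at h4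
  have h5 : ∀ σ, ∑ ψ : AddChar G ℂ, f.coeff σ * ψ (-σ) * ψ τ
      = f.coeff σ * if τ = σ then (Fintype.card G : ℂ) else 0 := fun σ => by
    have := AddChar.sum_apply_eq_ite (τ - σ)
    simp only [sub_eq_zero] at this
    rw [← this, Finset.mul_sum]
    refine Finset.sum_congr rfl fun ψ _ => ?_
    rw [mul_assoc, ← AddChar.map_add_eq_mul, neg_add_eq_sub]
  simp only [h5, mul_ite, mul_zero, Finset.sum_ite_eq, Finset.mem_univ, if_true] at h4
  simpa using h4

end Fourier

/-- The Fourier transform of `A_x` at `ι_1(v)`, without the factor `|G_ℓ|^{-1/2}`. The sum makes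
sense for all real vectors `v`, in and outside of `M°`. -/
def alternatingSum (X : AffineType) (ℓ : ℕ) (x v : X.Space) : ℂ :=
  ∑ᶠ w : X.weylGroup, X.sign w * starRingEnd ℂ (Circle.exp
    (2 * Real.pi / (ℓ + X.dualCoxeter : ℕ) * X.form v ((w : X.Space ≃ₗ[ℝ] X.Space) x)) : ℂ)

theorem fourier_alternant (X : AffineType) (ℓ : ℕ) (x : X.weightLattice) (v : X.dualM) :
    fourier (X.alternant ℓ x) (X.iota ℓ v)
      = (((Nat.card (X.G ℓ) : ℝ) ^ (-(1 / 2) : ℝ) : ℝ) : ℂ) * X.alternatingSum ℓ x v := by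
  classical
  have := Fintype.ofFinite (X.G ℓ)
  have := Fintype.ofFinite X.weylGroup
  rw [fourier_eq_sum, alternant, alternatingSum, finsum_eq_sum_of_fintype,
    finsum_eq_sum_of_fintype]
  congr 1
  simp only [AddMonoidAlgebra.coeff_sum, AddMonoidAlgebra.coeff_single, Finsupp.coe_finsetSum,
    Finset.sum_apply, Finset.sum_mul]
  rw [Finset.sum_comm]
  refine Finset.sum_congr rfl fun w _ => ?_
  rw [Finset.sum_eq_single (QuotientAddGroup.mk (X.act w x) : X.G ℓ)]
  · rw [Finsupp.single_eq_same, iota_mk]; rfl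
  · intro σ _ hσ
    rw [Finsupp.single_eq_of_ne hσ, zero_mul]
  · simp

theorem alternatingSum_weyl (X : AffineType) (ℓ : ℕ) (x v : X.Space) (u : X.weylGroup) :
    X.alternatingSum ℓ x ((u : X.Space ≃ₗ[ℝ] X.Space) v) = X.sign u * X.alternatingSum ℓ x v := by
  have := Fintype.ofFinite X.weylGroup
  rw [alternatingSum, alternatingSum, finsum_eq_sum_of_fintype, finsum_eq_sum_of_fintype,
    ← Equiv.sum_comp (Equiv.mulLeft u), Finset.mul_sum]
  refine Finset.sum_congr rfl fun w _ => ?_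
  rw [Equiv.coe_mulLeft, sign_mul, mul_assoc]
  have : X.form ((u : X.Space ≃ₗ[ℝ] X.Space) v) (((u * w : X.weylGroup) : X.Space ≃ₗ[ℝ] X.Space) x)
      = X.form v ((w : X.Space ≃ₗ[ℝ] X.Space) x) := X.form_weyl u _ _
  rw [this]

theorem alternatingSum_add (X : AffineType) (ℓ : ℕ) {x : X.Space} (hx : x ∈ X.weightLattice)
    (v : X.Space) {q : X.Space} (hq : q ∈ X.dualP) :
    X.alternatingSum ℓ x (v + ((ℓ + X.dualCoxeter : ℕ) : ℝ) • q) = X.alternatingSum ℓ x v := by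
  have hk : ((ℓ + X.dualCoxeter : ℕ) : ℝ) ≠ 0 := by exact_mod_cast (X.level_pos ℓ).ne'
  unfold alternatingSum
  refine finsum_congr fun w => ?_
  obtain ⟨m, hm⟩ := hq _ (X.weylGroup_mem w hx)
  congr 3
  refine Circle.exp_eq_exp.2 ⟨m, ?_⟩
  rw [map_add, map_smul, LinearMap.add_apply, LinearMap.smul_apply, smul_eq_mul, hm]
  field_simp

end

noncomputable section

/-! ### Coefficients of the alternants -/

theorem bar_add_rho_apply (X : AffineType) (l : X.AffineWeight) (i : Fin X.rank) :
    ((X.bar l + X.bar X.rho : X.weightLattice) : X.Space) i = l i.succ + 1 := by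
  change (l i.succ : ℝ) + ((X.rho i.succ : ℤ) : ℝ) = _
  simp [rho]

theorem form_theta_bar_add_rho (X : AffineType) {ℓ : ℕ} {l : X.AffineWeight}
    (hl : l ∈ X.dominantWeights ℓ) :
    X.form X.theta (X.bar l + X.bar X.rho : X.weightLattice)
      = (ℓ + X.dualCoxeter : ℕ) - (l 0 + 1) := by
  have h := hl.2
  rw [Fin.sum_univ_succ] at h
  have h' : (l 0 : ℝ) + ∑ i : Fin X.rank, (X.dualLabel (i + 1) : ℝ) * l i.succ = ℓ := by
    have := congrArg (Int.cast : ℤ → ℝ) h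
    simpa [dualLabel_zero] using this
  rw [form_theta, dualCoxeter_eq]
  simp only [bar_add_rho_apply, mul_add, Finset.sum_add_distrib, mul_one]
  push_cast
  linarith

theorem dominantWeights_ext (X : AffineType) {ℓ : ℕ} {l l' : X.AffineWeight}
    (hl : l ∈ X.dominantWeights ℓ) (hl' : l' ∈ X.dominantWeights ℓ)
    (h : (X.bar l + X.bar X.rho : X.weightLattice) = X.bar l' + X.bar X.rho) : l = l' := by
  have h0 := X.form_theta_bar_add_rho hl
  rw [h, X.form_theta_bar_add_rho hl'] at h0
  ext i
  refine Fin.cases ?_ (fun i => ?_) i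
  · have : (l 0 : ℝ) = l' 0 := by linarith
    exact_mod_cast this
  · have h1 := X.bar_add_rho_apply l i
    rw [h, bar_add_rho_apply] at h1
    have : (l i.succ : ℝ) = l' i.succ := by linarith
    exact_mod_cast this

/-- The points `λ̄ + ρ̄`, `λ ∈ P_ℓ^+`, lie in the open alcove of level `ℓ + h^∨`. So they are
inequivalent under the affine Weyl group and have trivial stabilizers, and `e^{λ̄' + ρ̄}` occurs in
`A_{λ̄ + ρ̄}` only if `λ = λ'`, with the coefficient `1`. -/
theorem coeff_alternant (X : AffineType) {ℓ : ℕ} {l l' : X.AffineWeight} [Decidable (l = l')]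
    (hl : l ∈ X.dominantWeights ℓ) (hl' : l' ∈ X.dominantWeights ℓ) :
    (X.alternant ℓ (X.bar l + X.bar X.rho)).coeff
      (QuotientAddGroup.mk (X.bar l' + X.bar X.rho)) = if l = l' then 1 else 0 := by
  classical
  have := Fintype.ofFinite X.weylGroup
  have hpos : ∀ {m : X.AffineWeight}, m ∈ X.dominantWeights ℓ → ∀ i,
      0 < ((X.bar m + X.bar X.rho : X.weightLattice) : X.Space) i := fun {m} hm i => by
    rw [bar_add_rho_apply]
    have : (0 : ℝ) ≤ m i.succ := by exact_mod_cast hm.1 i.succ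
    linarith
  have hlt : ∀ {m : X.AffineWeight}, m ∈ X.dominantWeights ℓ →
      X.form X.theta (X.bar m + X.bar X.rho : X.weightLattice) < (ℓ + X.dualCoxeter : ℕ) :=
      fun {m} hm => by
    rw [X.form_theta_bar_add_rho hm]
    have : (0 : ℝ) ≤ m 0 := by exact_mod_cast hm.1 0
    linarith
  have key : ∀ w : X.weylGroup,
      (QuotientAddGroup.mk (X.act w (X.bar l + X.bar X.rho)) : X.G ℓ)
        = QuotientAddGroup.mk (X.bar l' + X.bar X.rho) → w = 1 ∧ l = l' := fun w hw => by
    rw [QuotientAddGroup.eq, mem_scaledM] at hw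
    obtain ⟨m, hm, hmx⟩ := hw
    have h1 : ((X.bar l' + X.bar X.rho : X.weightLattice) : X.Space)
        = (w : X.Space ≃ₗ[ℝ] X.Space) (X.bar l + X.bar X.rho : X.weightLattice)
          + ((ℓ + X.dualCoxeter : ℕ) : ℝ) • m := by
      rw [← hmx]
      exact (add_neg_cancel_left _ _).symm
    obtain ⟨h2, h3⟩ := eq_one_and_eq_of_mem_alcove (hpos hl) (hlt hl) (hpos hl') (hlt hl') w hm h1
    exact ⟨h2, X.dominantWeights_ext hl hl' (Subtype.ext h3)⟩
  rw [alternant, finsum_eq_sum_of_fintype, AddMonoidAlgebra.coeff_sum, Finsupp.coe_finsetSum,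
    Finset.sum_apply]
  simp only [AddMonoidAlgebra.coeff_single]
  rw [Finset.sum_eq_single 1]
  · rw [sign_one]
    split_ifs with h
    · subst h
      exact Finsupp.single_eq_same
    · refine Finsupp.single_eq_of_ne fun h' => h (key 1 h'.symm).2
  · intro w _ hw
    exact Finsupp.single_eq_of_ne fun h' => hw (key w h'.symm).1
  · simp

/-! ### Linear independence -/

/-- The highest root `η = ∑ i ≥ 1, c_i α_i` of the finite-dimensional algebra. -/
def highRoot (X : AffineType) : X.Space := X.rootVec fun i => (X.coweightLabel (i + 1) : ℝ)

/-- Properties of the highest root `η`: for `D = (η | η) / 2`, which is `a_0` or `r` according as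
`r ≤ a_0` or `r > a_0`, the vector `D⁻¹ η` is integral on `P°`, and the reflection in `η` belongs
to the finite Weyl group and has sign `-1`. -/
theorem exists_reflection_highRoot (X : AffineType) : ∃ D : ℝ, 0 < D ∧
    X.form X.highRoot X.highRoot = 2 * D ∧ D⁻¹ • X.highRoot ∈ X.dualP ∧
    ∃ w : X.weylGroup, X.sign w = -1 ∧ ∀ x : X.Space, (w : X.Space ≃ₗ[ℝ] X.Space) x
      = x - (X.form X.highRoot x / D) • X.highRoot := by
  obtain ⟨D, hD, z, hz, hn⟩ : ∃ D : ℝ, 0 < D ∧ ∃ z : Fin X.rank → ℤ,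
      (∀ i, X.ratio i * X.coweightLabel (i + 1) = D * z i) ∧
      X.form X.highRoot X.highRoot = 2 * D := by
    rcases le_or_gt X.r (X.label 0) with h | h
    · have hη : X.highRoot = X.theta := by
        rw [highRoot, theta_eq_rootVec]
        simp only [X.coweightLabel_eq_label h]
      choose z hz using X.label_zero_dvd_dualLabel
      refine ⟨X.label 0, X.label_zero_pos, fun i => z i, fun i => ?_, by rw [hη, form_theta_theta]⟩
      have := X.label_ne_zero i
      rw [X.coweightLabel_eq_label h, ratio, hz]
      push_cast
      field_simp
    · obtain ⟨z, hz, hsum⟩ := X.exists_highRoot_corootCoeff h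
      have hr : (0 : ℝ) < X.r := by exact_mod_cast (Nat.zero_le _).trans_lt h
      have hz' : ∀ i : Fin X.rank, X.ratio i * X.coweightLabel (i + 1) = X.r * z (i + 1) :=
        fun i => by
        have h1 : (X.dualLabel (i + 1) : ℝ) * X.coweightLabel (i + 1)
            = X.r * X.label (i + 1) * z (i + 1) := by
          exact_mod_cast hz (i + 1) (by omega) (by omega)
        have := X.label_ne_zero i
        rw [ratio]
        field_simp
        linarith
      refine ⟨X.r, hr, fun i => z (i + 1), fun i => by simpa using hz' i, ?_⟩
      have hrow : ∀ i : ℕ, ∑ j ∈ Finset.range (X.rank + 1), X.cartanEntry i j *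
          (if j = 0 then 0 else (X.coweightLabel j : ℤ))
          = ∑ j : Fin X.rank, X.cartanEntry i (j + 1) * X.coweightLabel (j + 1) := fun i => by
        rw [← Fin.sum_univ_eq_sum_range (fun j => X.cartanEntry i j *
          (if j = 0 then 0 else (X.coweightLabel j : ℤ))), Fin.sum_univ_succ]
        simp
      simp only [hrow] at hsum
      rw [← Fin.sum_univ_eq_sum_range (fun i => (if i = 0 then 0 else (z i : ℤ)) *
        ∑ j : Fin X.rank, X.cartanEntry i (j + 1) * X.coweightLabel (j + 1)),
        Fin.sum_univ_succ] at hsum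
      simp only [Fin.val_zero, if_true, zero_mul, zero_add, Fin.val_succ, Nat.succ_ne_zero,
        if_false] at hsum
      have hsum' := congrArg (Int.cast : ℤ → ℝ) hsum
      push_cast at hsum'
      rw [highRoot, form_rootVec, ← hsum', Finset.sum_mul]
      refine Finset.sum_congr rfl fun i _ => ?_
      rw [rootVec_apply]
      simp only [finiteCartan, Matrix.of_apply]
      linear_combination (∑ j : Fin X.rank, (X.cartanEntry (i + 1) (j + 1) : ℝ) *
        X.coweightLabel (j + 1)) * hz' i
  refine ⟨D, hD, hn, fun x hx => ?_, ?_⟩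
  · choose m hm using hx
    refine ⟨∑ i, z i * m i, ?_⟩
    rw [map_smul, LinearMap.smul_apply, highRoot, form_rootVec, smul_eq_mul, Finset.mul_sum]
    push_cast
    refine Finset.sum_congr rfl fun i _ => ?_
    have h1 : x i = m i := hm i
    rw [h1]
    field_simp
    linear_combination (m i : ℝ) * hz i
  · have := X.exists_weyl_eq_reflection hD (∑ i : Fin X.rank, X.coweightLabel (i + 1))
      (fun i => X.coweightLabel (i + 1)) (fun i => by positivity) (by push_cast; exact le_rfl)
      (fun i => ⟨z i, by simpa using hz i⟩) (by simpa [highRoot] using hn)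
    simpa [highRoot] using this

/-- The alternants have linearly independent Fourier transforms on every set `S` that contains the
characters `ι_1(v)` for all `v ∈ M°` in the open alcove `v_i > 0`, `(η | v) < ℓ + h^∨`. -/
theorem linearIndependent_fourier_alternant (X : AffineType) (ℓ : ℕ)
    (S : Set (AddChar (X.G ℓ) Circle))
    (hS : ∀ v : X.dualM, (∀ i, 0 < (v : X.Space) i) →
      X.form X.highRoot v < (ℓ + X.dualCoxeter : ℕ) → X.iota ℓ v ∈ S) :
    LinearIndependent ℂ (fun (l : X.dominantWeights ℓ) (χ : S) =>
      fourier (X.alternant ℓ (X.bar l + X.bar X.rho)) χ) := by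
  classical
  rw [linearIndependent_iff']
  intro s g hg l hl
  set k : ℝ := ((ℓ + X.dualCoxeter : ℕ) : ℝ) with hk
  set f := ∑ l ∈ s, g l • X.alternant ℓ (X.bar l + X.bar X.rho) with hf
  set F : X.Space → ℂ := fun v => ∑ l ∈ s, g l *
    X.alternatingSum ℓ (X.bar l + X.bar X.rho : X.weightLattice) v with hF
  have hFf : ∀ v : X.dualM, fourier f (X.iota ℓ v)
      = (((Nat.card (X.G ℓ) : ℝ) ^ (-(1 / 2) : ℝ) : ℝ) : ℂ) * F v := fun v => by
    rw [hf, fourier_sum_smul, hF, Finset.mul_sum]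
    refine Finset.sum_congr rfl fun l _ => ?_
    rw [fourier_alternant]; ring
  have hc : (((Nat.card (X.G ℓ) : ℝ) ^ (-(1 / 2) : ℝ) : ℝ) : ℂ) ≠ 0 := by
    have : (0 : ℝ) < Nat.card (X.G ℓ) := by exact_mod_cast Nat.card_pos
    exact_mod_cast (Real.rpow_pos_of_pos this _).ne'
  have hFw : ∀ (w : X.weylGroup) (v : X.Space),
      F ((w : X.Space ≃ₗ[ℝ] X.Space) v) = X.sign w * F v := fun w v => by
    simp only [hF, Finset.mul_sum, alternatingSum_weyl]
    refine Finset.sum_congr rfl fun l _ => by ring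
  have hFq : ∀ v : X.Space, ∀ q ∈ X.dualP, F (v + k • q) = F v := fun v q hq => by
    simp only [hF]
    refine Finset.sum_congr rfl fun l _ => ?_
    rw [X.alternatingSum_add ℓ (Subtype.prop _) v hq]
  obtain ⟨D, hD, hη, hηP, w₀, hw₀, hw₀x⟩ := X.exists_reflection_highRoot
  -- `F` vanishes on `M°`: it suffices to consider points of the closed alcove.
  have hF0 : ∀ v : X.dualM, F v = 0 := by
    intro v
    obtain ⟨w, q, hq, hpos, hle⟩ := X.exists_mem_closed_alcove
      (k := k) (by rw [hk]; exact_mod_cast X.level_pos ℓ) hD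
      (fun i => X.coweightLabel (i + 1)) hη w₀ hw₀x hηP v
    set u := (w : X.Space ≃ₗ[ℝ] X.Space) v + k • q with hu
    have huM : u ∈ X.dualM := by
      refine add_mem (X.weyl_mem_dualM w v.2) ?_
      rw [hk, Nat.cast_smul_eq_nsmul]
      exact nsmul_mem (X.dualP_le_dualM hq) _
    have hFu : F u = X.sign w * F v := by rw [hu, hFq _ _ hq, hFw]
    have hsign : X.sign w ≠ 0 := pow_ne_zero _ (by norm_num)
    suffices F u = 0 by
      rw [hFu] at this
      exact (mul_eq_zero.1 this).resolve_left hsign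
    by_cases hint : (∀ i, 0 < u i) ∧ X.form X.highRoot u < k
    · have h1 := congrFun hg ⟨_, hS ⟨u, huM⟩ hint.1 hint.2⟩
      rw [Finset.sum_apply] at h1
      simp only [Pi.smul_apply, smul_eq_mul, Pi.zero_apply] at h1
      have h2 := hFf ⟨u, huM⟩
      rw [hf, fourier_sum_smul, h1] at h2
      exact (mul_eq_zero.1 h2.symm).resolve_left hc
    -- On a wall of the alcove the antisymmetry under the reflection in the wall gives `F u = -F u`.
    · have hneg : F u = -F u := by
        rw [not_and_or] at hint
        rcases hint with h | h
        · push Not at h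
          obtain ⟨i, hi⟩ := h
          have hui : u i = 0 := le_antisymm hi (hpos i)
          have h1 := hFw (X.simpleWeyl i) u
          have h2 : ((X.simpleWeyl i : X.weylGroup) : X.Space ≃ₗ[ℝ] X.Space) u = u := by
            refine (X.simpleReflection_apply i u).trans ?_
            rw [hui, zero_smul, sub_zero]
          rwa [h2, sign_simpleWeyl, neg_one_mul] at h1
        · have huk : X.form X.highRoot u = k := le_antisymm hle (not_lt.1 h)
          have h1 := hFw w₀ u
          rw [← hFq _ _ hηP, hw₀x, huk, hw₀, smul_smul, ← div_eq_mul_inv, sub_add_cancel,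
            neg_one_mul] at h1
          exact h1
      exact self_eq_neg.1 hneg
  have hf0 : f = 0 := eq_zero_of_fourier_eq_zero fun χ => by
    obtain ⟨v, rfl⟩ := X.iota_surjective ℓ χ
    rw [hFf, hF0, mul_zero]
  -- The coefficient of `f` at `l + ρ` is `g l`.
  have h1 := congrArg (fun f => AddMonoidAlgebra.coeff f
    (QuotientAddGroup.mk (X.bar l + X.bar X.rho))) hf0
  simp only [hf, AddMonoidAlgebra.coeff_sum, AddMonoidAlgebra.coeff_smul, Finsupp.coe_finsetSum,
    Finset.sum_apply, Finsupp.smul_apply, smul_eq_mul, AddMonoidAlgebra.coeff_zero,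
    Finsupp.coe_zero, Pi.zero_apply] at h1
  rw [Finset.sum_eq_single l] at h1
  · rw [X.coeff_alternant l.2 l.2, if_pos rfl, mul_one] at h1
    exact h1
  · intro l' _ hl'
    rw [X.coeff_alternant l'.2 l.2, if_neg (fun h => hl' (Subtype.ext h)), mul_zero]
  · exact fun h => absurd hl h

/-- If `r ≤ a_0`, the points of `M°` in the open alcove are vectors `μ̄ + ρ̄` with `μ ∈ P_ℓ^+`; the
coefficient of `Λ_0` in `μ` is determined by the level. -/
theorem iota_mem_weightPoints (X : AffineType) (ℓ : ℕ) (hX : X.r ≤ X.label 0) (v : X.dualM)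
    (hpos : ∀ i, 0 < (v : X.Space) i)
    (hlt : X.form X.highRoot v < (ℓ + X.dualCoxeter : ℕ)) : X.iota ℓ v ∈ X.weightPoints ℓ := by
  have hη : X.highRoot = X.theta := by
    rw [highRoot, theta_eq_rootVec]
    simp only [X.coweightLabel_eq_label hX]
  have hint : ∀ i, ∃ m : ℤ, (v : X.Space) i = m := fun i => by
    obtain ⟨m, hm⟩ := v.2 _ (X.corootVec_mem_latticeM hX i)
    refine ⟨m, ?_⟩
    have := (X.ratio_pos i).ne'
    rw [map_smul, form_comm, form_simpleRoot, smul_eq_mul] at hm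
    rw [← hm]
    field_simp
  choose m hm using hint
  have hsum : X.form X.theta v = (∑ i : Fin X.rank, X.dualLabel (i + 1) * m i : ℤ) := by
    rw [form_theta]; simp [hm]
  rw [hη, hsum] at hlt
  have hlt' : (∑ i : Fin X.rank, X.dualLabel (i + 1) * m i : ℤ) < (ℓ + X.dualCoxeter : ℕ) := by
    exact_mod_cast hlt
  refine ⟨Fin.cons ((ℓ + X.dualCoxeter : ℕ) - (∑ i : Fin X.rank, X.dualLabel (i + 1) * m i : ℤ) - 1)
    (fun i => m i - 1), ⟨fun i => ?_, ?_⟩, v, ?_, rfl⟩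
  · refine Fin.cases ?_ (fun i => ?_) i
    · rw [Fin.cons_zero]; omega
    · have := hpos i
      rw [hm] at this
      have : 0 < m i := by exact_mod_cast this
      rw [Fin.cons_succ]; omega
  · rw [Fin.sum_univ_succ]
    simp only [Fin.cons_zero, Fin.cons_succ, Fin.val_zero, Fin.val_succ, dualLabel_zero, mul_sub,
      mul_one, Finset.sum_sub_distrib, dualCoxeter_eq]
    push_cast
    ring
  · ext i
    rw [Pi.add_apply]
    simp [bar, rho, hm]

theorem coweightLabel_zero (X : AffineType) : X.coweightLabel 0 = 1 := by
  cases X <;> simp [coweightLabel]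

/-- If `r > a_0`, the points of `M°` in the open alcove are vectors `μ̄ + ρ̄^∨` with
`μ ∈ P_ℓ^{∨+}`. The coweight `ρ^∨` has level `h^∨` because the levels `c_i` are a rearrangement of
the dual labels. -/
theorem iota_mem_coweightPoints (X : AffineType) (ℓ : ℕ) (hX : X.label 0 < X.r) (v : X.dualM)
    (hpos : ∀ i, 0 < (v : X.Space) i)
    (hlt : X.form X.highRoot v < (ℓ + X.dualCoxeter : ℕ)) : X.iota ℓ v ∈ X.coweightPoints ℓ := by
  have hcox : (X.dualCoxeter : ℤ) = 1 + ∑ i : Fin X.rank, (X.coweightLabel (i + 1) : ℤ) := by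
    obtain ⟨σ, hσ⟩ := X.exists_perm_coweightLabel hX
    have : X.dualCoxeter = ∑ i : Fin (X.rank + 1), X.coweightLabel i := by
      simp only [hσ]
      exact (Equiv.sum_comp σ fun i => X.dualLabel i).symm
    rw [this, Fin.sum_univ_succ]
    simp [coweightLabel_zero]
  have hint : ∀ i, ∃ m : ℤ, X.ratio i * (v : X.Space) i = m := fun i => by
    obtain ⟨m, hm⟩ := v.2 _ (X.simpleRoot_mem_latticeM hX i)
    exact ⟨m, by rw [← hm, form_comm, form_simpleRoot]⟩
  choose m hm using hint
  have hsum : X.form X.highRoot v = (∑ i : Fin X.rank, X.coweightLabel (i + 1) * m i : ℤ) := by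
    rw [highRoot, form_rootVec]; simp [hm]
  rw [hsum] at hlt
  have hlt' : (∑ i : Fin X.rank, X.coweightLabel (i + 1) * m i : ℤ) < (ℓ + X.dualCoxeter : ℕ) := by
    exact_mod_cast hlt
  refine ⟨Fin.cons ((ℓ + X.dualCoxeter : ℕ)
    - (∑ i : Fin X.rank, X.coweightLabel (i + 1) * m i : ℤ) - 1)
    (fun i => m i - 1), ⟨fun i => ?_, ?_⟩, v, ?_, rfl⟩
  · refine Fin.cases ?_ (fun i => ?_) i
    · rw [Fin.cons_zero]; omega
    · have h1 := mul_pos (X.ratio_pos i) (hpos i)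
      rw [hm] at h1
      have : 0 < m i := by exact_mod_cast h1
      rw [Fin.cons_succ]; omega
  · rw [Fin.sum_univ_succ]
    simp only [Fin.cons_zero, Fin.cons_succ, Fin.val_zero, Fin.val_succ, coweightLabel_zero,
      mul_sub, mul_one, Finset.sum_sub_distrib]
    push_cast
    rw [hcox]
    ring
  · ext i
    have h1 := hm i
    have h2 := X.label_ne_zero i
    have h3 := X.dualLabel_ne_zero i
    rw [ratio] at h1
    rw [Pi.add_apply]
    simp only [cobar, rhoCheck, Fin.cons_succ]
    push_cast
    rw [← h1]
    field_simp
    ring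

/-! ### Counting weights and coweights -/

theorem finite_setOf_level {n : ℕ} (a : Fin n → ℕ) (ha : ∀ i, 0 < a i) (ℓ : ℕ) :
    {m : Fin n → ℤ | (∀ i, 0 ≤ m i) ∧ ∑ i, (a i : ℤ) * m i = ℓ}.Finite := by
  refine (Set.finite_Icc (fun _ => 0 : Fin n → ℤ) (fun _ => (ℓ : ℤ))).subset ?_
  rintro m ⟨h0, hs⟩
  refine ⟨fun i => h0 i, fun i => ?_⟩
  have h1 := Finset.single_le_sum (f := fun i => (a i : ℤ) * m i)
    (fun j _ => mul_nonneg (by positivity) (h0 j)) (Finset.mem_univ i)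
  have h2 : (1 : ℤ) ≤ a i := by exact_mod_cast ha i
  change m i ≤ ℓ
  nlinarith [h0 i]

theorem ncard_dominantWeights (X : AffineType) (hX : X.label 0 < X.r) (ℓ : ℕ) :
    (X.dominantWeights ℓ).ncard = (X.dominantCoweights ℓ).ncard := by
  obtain ⟨σ, hσ⟩ := X.exists_perm_coweightLabel hX
  refine Set.ncard_congr (fun m _ => m ∘ σ) ?_ ?_ ?_
  · rintro m ⟨h0, hs⟩
    refine ⟨fun i => h0 _, ?_⟩
    rw [← hs]
    simp only [hσ, Function.comp_apply]
    exact Equiv.sum_comp σ fun i => (X.dualLabel i : ℤ) * m i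
  · intro m m' _ _ h
    exact σ.surjective.injective_comp_right h
  · rintro m ⟨h0, hs⟩
    refine ⟨m ∘ σ.symm, ⟨fun i => h0 _, ?_⟩, by ext i; simp⟩
    rw [← hs, ← Equiv.sum_comp σ]
    simp [hσ]

end

end AffineType

theorem mainTheorem5 (X : AffineType) (ℓ : ℕ) (hℓ : 0 < ℓ) :
    (X.r ≤ X.label 0 →
      LinearIndependent ℂ
        (fun (l : X.dominantWeights ℓ) (χ : X.weightPoints ℓ) =>
          AffineType.fourier (X.alternant ℓ (X.bar l + X.bar X.rho)) χ)) ∧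
    (X.label 0 < X.r →
      LinearIndependent ℂ
        (fun (l : X.dominantWeights ℓ) (χ : X.coweightPoints ℓ) =>
          AffineType.fourier (X.alternant ℓ (X.bar l + X.bar X.rho)) χ) ∧
      (X.dominantWeights ℓ).Finite ∧ (X.dominantCoweights ℓ).Finite ∧
      (X.dominantWeights ℓ).ncard = (X.dominantCoweights ℓ).ncard) := by
  refine ⟨fun hX => X.linearIndependent_fourier_alternant ℓ _ fun v hpos hlt =>
    X.iota_mem_weightPoints ℓ hX v hpos hlt, fun hX => ⟨?_, ?_, ?_, ?_⟩⟩
  · exact X.linearIndependent_fourier_alternant ℓ _ fun v hpos hlt =>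
      X.iota_mem_coweightPoints ℓ hX v hpos hlt
  · exact AffineType.finite_setOf_level _ (fun i => X.dualLabel_pos i (by omega)) ℓ
  · obtain ⟨σ, hσ⟩ := X.exists_perm_coweightLabel hX
    refine AffineType.finite_setOf_level _ (fun i => ?_) ℓ
    rw [hσ]
    exact X.dualLabel_pos _ (by omega)
  · exact X.ncard_dominantWeights hX ℓ
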